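/- Let $\mathbb K$ be $\mathbb R$ or $\mathbb C$, and let $\mathfrak g=\mathfrak g_{\bar 0}\oplus\mathfrak g_{\bar 1}$ be a finite-dimensional Lie superalgebra over $\mathbb K$ with homogeneous basis $X_1,\dots,X_{m+n}$, where $X_i$ is even for $i\le m$ and odd for $i>m$. Let $S(\mathfrak g)$ be the supersymmetric algebra of $\mathfrak g$ and $U(\mathfrak g)$ its universal enveloping algebra. For a parity-preserving linear map $f$ from $\mathfrak g$ to an associative superalgebra $A$, the symmetrisation along $f$ is the linear map $\sigma_f\colon S(\mathfrak g)\to A$ with $$\sigma_f(a_1\cdots a_r)=\frac1{r!}\sum_{\tau\in S_r}(-1)^{|\tau|}f(a_{\tau(1)})\cdots f(a_{\tau(r)})$$ for homogeneous $a_1,\dots,a_r\in\mathfrak g$, where $|\tau|$ is the number of pairs $i<j$ with $a_i,a_j$ odd and $\tau^{-1}(i)>\tau^{-1}(j)$. Let $\sigma=\sigma_f\colon S(\mathfrak g)\to U(\mathfrak g)$ for $f$ the canonical map $\mathfrak g\to U(\mathfrak g)$. For $K=(k_1,\dots,k_{m+n})\in\mathbb N^{m|n}=\mathbb N^m\times\{0,1\}^n$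 put $|K|=\sum_i k_i$, $K!=k_1!\cdots k_m!$ and $\partial^K=(\partial^1)^{k_1}\cdots(\partial^{m+n})^{k_{m+n}}$, where $\partial^i$ is the super derivation of $S(\mathfrak g)$ with $\partial^iX_j=\delta_{ij}$, that is, $\partial^i(ab)=\partial^i(a)\,b+(-1)^{|X_i||a|}a\,\partial^i(b)$ for homogeneous $a$. Let $s^K_{\mathfrak g}\in\operatorname{End}(\mathfrak g)$ be the symmetrisation of $\widetilde{\mathrm{ad}}_{X_1}^{\,k_1}\cdots\widetilde{\mathrm{ad}}_{X_{m+n}}^{\,k_{m+n}}$, where $\widetilde{\mathrm{ad}}_Z(Y)=[Y,Z]$; in other words, $s^K_{\mathfrak g}=\sigma_f(X_1^{k_1}\cdots X_{m+n}^{k_{m+n}})$ for $f=\widetilde{\mathrm{ad}}\colon\mathfrak g\to\operatorname{End}(\mathfrak g)$. Let $B_i$ be the Bernoulli numbers, with $B_1=-\tfrac12$. **Theorem 3.2 (Berezin theorem).** The map $\sigma\colon S(\mathfrak g)\to U(\mathfrak g)$ is a linear isomorphism, and the action $\pi(X)Y:=\sigma^{-1}(X\,\sigma(Y))$ of $X\in\mathfrak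 g$ on $Y\in S(\mathfrak g)$ is given by $$\pi(X)Y=\sum_{K\in\mathbb N^{m|n}}\frac{(-1)^{|K|}B_{|K|}}{K!}\,s^K_{\mathfrak g}(X)\,\partial^KY ,$$ where, for each $Y$, only finitely many of the $\partial^KY$ are non-zero. -/

import Mathlib

namespace SuperLie

/-- The Koszul sign `(-1)^{ij}` for parities `i, j ∈ ℤ/2`. -/
def sgn (K : Type*) [Ring K] (i j : ZMod 2) : K := (-1) ^ (i.val * j.val)

/-- The sign `(-1)^{|τ|}` of a permutation `τ` acting on `n` homogeneous objects of parities `p`: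
`|τ|` is the number of pairs `i < j` of odd objects with `τ⁻¹ i > τ⁻¹ j`. -/
def koszulSign (K : Type*) [CommRing K] {n : ℕ} (p : Fin n → ZMod 2) (τ : Equiv.Perm (Fin n)) : K :=
  ∏ i, ∏ j, if i < j ∧ p i = 1 ∧ p j = 1 ∧ τ⁻¹ j < τ⁻¹ i then -1 else 1

section SuperSpace

variable {K V : Type*} [Field K] [AddCommGroup V] [Module K V]
variable (𝒱 : ZMod 2 → Submodule K V)

/-- The defining relations `x • y = (-1)^{|x||y|} y • x`, for homogeneous `x, y`, of the
supersymmetric algebra of the super vector space `V = 𝒱 0 ⊕ 𝒱 1`. -/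
inductive SymRel : TensorAlgebra K V → TensorAlgebra K V → Prop
  | comm {i j : ZMod 2} {x y : V} (hx : x ∈ 𝒱 i) (hy : y ∈ 𝒱 j) :
      SymRel (TensorAlgebra.ι K x * TensorAlgebra.ι K y)
        (sgn K i j • (TensorAlgebra.ι K y * TensorAlgebra.ι K x))

/-- The ring congruence generated by `SymRel`. -/
def symCon : RingCon (TensorAlgebra K V) := ringConGen (SymRel 𝒱)

/-- The supersymmetric algebra `S(V)` of a super vector space `V = 𝒱 0 ⊕ 𝒱 1`. -/
abbrev SSym := (symCon 𝒱).Quotient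

/-- The inclusion `V → S(V)`. -/
def SSym.ι : V →ₗ[K] SSym 𝒱 :=
  (RingCon.mkₐ K (symCon 𝒱)).toLinearMap ∘ₗ TensorAlgebra.ι K

theorem SSym.ι_comm {i j : ZMod 2} {x y : V} (hx : x ∈ 𝒱 i) (hy : y ∈ 𝒱 j) :
    SSym.ι 𝒱 x * SSym.ι 𝒱 y = sgn K i j • (SSym.ι 𝒱 y * SSym.ι 𝒱 x) := by
  have h : symCon 𝒱 _ _ := RingCon.le_ringConGen _ _ (SymRel.comm hx hy)
  exact Quotient.sound h

theorem SSym.induction {C : SSym 𝒱 → Prop} (one : C 1)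
    (ι_mul : ∀ x a, C a → C (SSym.ι 𝒱 x * a)) (add : ∀ a b, C a → C b → C (a + b))
    (smul : ∀ (c : K) a, C a → C (c • a)) (a : SSym 𝒱) : C a := by
  obtain ⟨t, rfl⟩ := RingCon.mkₐ_surjective (α := K) (symCon 𝒱) a
  suffices h : ∀ b, C b → C (RingCon.mkₐ K (symCon 𝒱) t * b) by simpa using h 1 one
  induction t using TensorAlgebra.induction with
  | algebraMap r => intro b hb; simpa [← Algebra.smul_def] using smul r b hb
  | ι x => intro b hb; exact ι_mul x b hb
  | mul x y hx hy => intro b hb; rw [map_mul, mul_assoc]; exact hx _ (hy _ hb)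
  | add x y hx hy => intro b hb; rw [map_add, add_mul]; exact add _ _ (hx _ hb) (hy _ hb)

section Graded

variable [DirectSum.Decomposition 𝒱]

/-- The projection of `V = 𝒱 0 ⊕ 𝒱 1` onto its component of parity `i`. -/
def homPart (i : ZMod 2) : V →ₗ[K] V :=
  (𝒱 i).subtype ∘ₗ DirectSum.component K (ZMod 2) (fun i => 𝒱 i) i ∘ₗ
    (DirectSum.decomposeLinearEquiv 𝒱).toLinearMap

theorem homPart_same {i : ZMod 2} {x : V} (hx : x ∈ 𝒱 i) : homPart 𝒱 i x = x :=
  DirectSum.decompose_of_mem_same 𝒱 hx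

theorem homPart_ne {i j : ZMod 2} {x : V} (hx : x ∈ 𝒱 i) (hij : i ≠ j) : homPart 𝒱 j x = 0 :=
  DirectSum.decompose_of_mem_ne 𝒱 hx hij

theorem homPart_mem (i : ZMod 2) (x : V) : homPart 𝒱 i x ∈ 𝒱 i :=
  SetLike.coe_mem _

theorem homPart_add (x : V) : homPart 𝒱 0 x + homPart 𝒱 1 x = x := by
  classical
  have h2 : ∑ i : ZMod 2, ((DirectSum.decompose 𝒱 x) i : V) = x := by
    conv_rhs => rw [← DirectSum.sum_support_decompose 𝒱 x]
    symm
    apply Finset.sum_subset (Finset.subset_univ _)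
    intro i _ hi
    simpa using hi
  have h3 : (Finset.univ : Finset (ZMod 2)) = {0, 1} := rfl
  rw [h3, Finset.sum_pair (by decide)] at h2
  exact h2

end Graded

end SuperSpace

section Derivations

variable {K V : Type*} [Field K] [AddCommGroup V] [Module K V]
variable (𝒱 : ZMod 2 → Submodule K V) [DirectSum.Decomposition 𝒱]

/-- The linear map `x ↦ (-1)^{p|x|} x` from `V` to `S(V)`. -/
def twist (p : ZMod 2) : V →ₗ[K] SSym 𝒱 :=
  SSym.ι 𝒱 ∘ₗ (homPart 𝒱 0 + sgn K p 1 • homPart 𝒱 1)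

theorem twist_of_mem (p : ZMod 2) {i : ZMod 2} {x : V} (hx : x ∈ 𝒱 i) :
    twist 𝒱 p x = sgn K p i • SSym.ι 𝒱 x := by
  have hi : i = 0 ∨ i = 1 := by clear hx; revert i; decide
  rcases hi with rfl | rfl
  · have h1 : homPart 𝒱 0 x = x := homPart_same 𝒱 hx
    have h2 : homPart 𝒱 1 x = 0 := homPart_ne 𝒱 hx (by decide)
    simp [twist, h1, h2, sgn]
  · have h1 : homPart 𝒱 1 x = x := homPart_same 𝒱 hx
    have h2 : homPart 𝒱 0 x = 0 := homPart_ne 𝒱 hx (by decide)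
    simp [twist, h1, h2]

/-- The linear map `x ↦ [[(-1)^{p|x|} x, φ_p(x)], [0, x]]`, with `φ_p` the component of parity `p`
of the functional `φ`. The upper right entry of its extension to `S(V)` is a super derivation. -/
def derivMat (p : ZMod 2) (φ : V →ₗ[K] K) : V →ₗ[K] Matrix (Fin 2) (Fin 2) (SSym 𝒱) where
  toFun x := !![twist 𝒱 p x, algebraMap K (SSym 𝒱) (φ (homPart 𝒱 p x)); 0, SSym.ι 𝒱 x]
  map_add' x y := by
    ext i j; fin_cases i <;> fin_cases j <;> simp
  map_smul' c x := by
    ext i j; fin_cases i <;> fin_cases j <;> simp [Algebra.smul_def]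

theorem derivMat_comm (p : ZMod 2) (φ : V →ₗ[K] K) {i j : ZMod 2} {x y : V}
    (hx : x ∈ 𝒱 i) (hy : y ∈ 𝒱 j) :
    derivMat 𝒱 p φ x * derivMat 𝒱 p φ y =
      sgn K i j • (derivMat 𝒱 p φ y * derivMat 𝒱 p φ x) := by
  have hφ : ∀ {k : ZMod 2} {z : V}, z ∈ 𝒱 k → k ≠ p → φ (homPart 𝒱 p z) = 0 := by
    intro k z hz hk
    rw [homPart_ne 𝒱 hz hk, map_zero]
  have hc := SSym.ι_comm 𝒱 hx hy
  have hs : ∀ k l : ZMod 2, sgn K k l = sgn K l k := fun k l => by simp [sgn, mul_comm]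
  have hss : ∀ k l : ZMod 2, sgn K k l * sgn K k l = 1 := fun k l => by
    rw [sgn, ← mul_pow]; simp
  ext a b
  fin_cases a <;> fin_cases b
  · simp only [derivMat, LinearMap.coe_mk, AddHom.coe_mk, twist_of_mem 𝒱 p hx,
      twist_of_mem 𝒱 p hy]
    simp [hc, smul_smul]
    congr 1
    ring
  · have h1 : twist 𝒱 p x * algebraMap K (SSym 𝒱) (φ (homPart 𝒱 p y)) =
        sgn K i j • (algebraMap K (SSym 𝒱) (φ (homPart 𝒱 p y)) * SSym.ι 𝒱 x) := by
      by_cases h : j = p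
      · subst h
        rw [twist_of_mem 𝒱 _ hx, hs i j, smul_mul_assoc, Algebra.commutes]
      · simp [hφ hy h]
    have h2 : algebraMap K (SSym 𝒱) (φ (homPart 𝒱 p x)) * SSym.ι 𝒱 y =
        sgn K i j • (twist 𝒱 p y * algebraMap K (SSym 𝒱) (φ (homPart 𝒱 p x))) := by
      by_cases h : i = p
      · subst h
        rw [twist_of_mem 𝒱 _ hy, smul_mul_assoc, smul_smul, hss, one_smul, Algebra.commutes]
      · simp [hφ hx h]
    simp only [derivMat, LinearMap.coe_mk, AddHom.coe_mk, Matrix.mul_apply, Fin.sum_univ_two,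
      Matrix.smul_apply]
    simp only [Fin.zero_eta, Fin.mk_one, Matrix.of_apply, Matrix.cons_val_zero,
      Matrix.cons_val_one, h1, h2, smul_add]
    rw [add_comm]
  · simp [derivMat]
  · simpa [derivMat] using hc

/-- The algebra morphism from `S(V)` to `2 × 2`-matrices over `S(V)` that extends `derivMat`. -/
def derivMatLift (p : ZMod 2) (φ : V →ₗ[K] K) :
    SSym 𝒱 →ₐ[K] Matrix (Fin 2) (Fin 2) (SSym 𝒱) :=
  RingCon.liftₐ (symCon 𝒱) (TensorAlgebra.lift K (derivMat 𝒱 p φ)) (by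
    refine RingCon.ringConGen_le.2 ?_
    intro a b h
    induction h with
    | comm hx hy =>
      rw [RingCon.ker_apply]
      simpa using derivMat_comm 𝒱 p φ hx hy)

/-- The super derivation `∂_φ` of `S(V)` with `∂_φ x = φ x` for `x ∈ V`: the sum of its even part,
determined by the even component of `φ`, and its odd part, determined by the odd component. -/
def pderiv (φ : V →ₗ[K] K) : Module.End K (SSym 𝒱) where
  toFun a := derivMatLift 𝒱 0 φ a 0 1 + derivMatLift 𝒱 1 φ a 0 1
  map_add' a b := by simp; abel
  map_smul' c a := by simp

theorem pderiv_one (φ : V →ₗ[K] K) : pderiv 𝒱 φ 1 = 0 := by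
  simp [pderiv]

theorem derivMatLift_ι (p : ZMod 2) (φ : V →ₗ[K] K) (x : V) :
    derivMatLift 𝒱 p φ (SSym.ι 𝒱 x) = derivMat 𝒱 p φ x :=
  TensorAlgebra.lift_ι_apply (R := K) (derivMat 𝒱 p φ) x

theorem derivMatLift_one_one (p : ZMod 2) (φ : V →ₗ[K] K) (a : SSym 𝒱) :
    derivMatLift 𝒱 p φ a 1 1 = a := by
  induction a using SSym.induction 𝒱 with
  | one => simp
  | ι_mul x a ha => simp [derivMatLift_ι, derivMat, Matrix.mul_apply, ha]
  | add a b ha hb => simp [ha, hb]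
  | smul c a ha => simp [ha]

/-- If `φ` is homogeneous of parity `p`, then `∂_φ` satisfies the super Leibniz rule. -/
theorem pderiv_ι_mul (φ : V →ₗ[K] K) {p : ZMod 2} (hφ : ∀ x ∈ 𝒱 (p + 1), φ x = 0)
    {i : ZMod 2} {x : V} (hx : x ∈ 𝒱 i) (a : SSym 𝒱) :
    pderiv 𝒱 φ (SSym.ι 𝒱 x * a) =
      φ x • a + sgn K p i • (SSym.ι 𝒱 x * pderiv 𝒱 φ a) := by
  have hq : ∀ a, derivMatLift 𝒱 (p + 1) φ a 0 1 = 0 := by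
    intro a
    induction a using SSym.induction 𝒱 with
    | one => simp
    | ι_mul x a ha =>
      simp [derivMatLift_ι, derivMat, Matrix.mul_apply, ha, hφ _ (homPart_mem 𝒱 (p + 1) x)]
    | add a b ha hb => simp [ha, hb]
    | smul c a ha => simp [ha]
  have hp : ∀ a, pderiv 𝒱 φ a = derivMatLift 𝒱 p φ a 0 1 := by
    intro a
    have h : p = 0 ∨ p = 1 := by clear hφ hq; revert p; decide
    rcases h with rfl | rfl
    · have := hq a
      simp only [zero_add] at this
      simp [pderiv, this]
    · have := hq a
      rw [show (1 : ZMod 2) + 1 = 0 from rfl] at this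
      simp [pderiv, this]
  have hx' : φ (homPart 𝒱 p x) = φ x := by
    by_cases h : i = p
    · subst h; rw [homPart_same 𝒱 hx]
    · have h' : i = p + 1 := by clear hx hφ hq hp; revert i p; decide
      rw [homPart_ne 𝒱 hx h, map_zero, hφ x (h' ▸ hx)]
  rw [hp, hp, map_mul, Matrix.mul_apply, Fin.sum_univ_two, derivMatLift_one_one, derivMatLift_ι]
  simp [derivMat, hx', twist_of_mem 𝒱 p hx, Algebra.smul_def, add_comm, mul_assoc]

end Derivations

section Symmetrisation

variable {K V A : Type*} [Field K] [AddCommGroup V] [Module K V] [Ring A] [Algebra K A]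
variable (𝒱 : ZMod 2 → Submodule K V) [DirectSum.Decomposition 𝒱]

/-- The multilinear map which on homogeneous `v₁, …, vₙ` takes the value
`1/n! ∑_τ (-1)^{|τ|} f(v_{τ(1)}) ⋯ f(v_{τ(n)})`; the sum over `p` runs over all parities. -/
noncomputable def symMultilinear (f : V →ₗ[K] A) (n : ℕ) :
    MultilinearMap K (fun _ : Fin n => V) A :=
  (n.factorial : K)⁻¹ • ∑ τ : Equiv.Perm (Fin n), ∑ p : Fin n → ZMod 2,
    koszulSign K p τ •
      (((MultilinearMap.mkPiAlgebraFin K n A).compLinearMap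
        fun i => f ∘ₗ homPart 𝒱 (p (τ i))).domDomCongr τ)

theorem symMultilinear_apply (f : V →ₗ[K] A) (n : ℕ) (v : Fin n → V) :
    symMultilinear 𝒱 f n v = (n.factorial : K)⁻¹ • ∑ τ : Equiv.Perm (Fin n),
      ∑ p : Fin n → ZMod 2, koszulSign K p τ •
        (List.ofFn fun i => f (homPart 𝒱 (p (τ i)) (v (τ i)))).prod := by
  simp [symMultilinear]

theorem prod_eq_zero_of_homPart (f : V →ₗ[K] A) {n : ℕ} {v : Fin n → V} (τ : Equiv.Perm (Fin n))
    (p : Fin n → ZMod 2) {k : Fin n} {i : ZMod 2} (hv : v k ∈ 𝒱 i) (hk : p k ≠ i) :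
    (List.ofFn fun i => f (homPart 𝒱 (p (τ i)) (v (τ i)))).prod = 0 := by
  apply List.prod_eq_zero
  rw [List.mem_ofFn]
  refine ⟨τ⁻¹ k, ?_⟩
  simp [homPart_ne 𝒱 hv hk.symm]

theorem symMultilinear_of_mem (f : V →ₗ[K] A) {n : ℕ} {v : Fin n → V} {p : Fin n → ZMod 2}
    (hv : ∀ i, v i ∈ 𝒱 (p i)) :
    symMultilinear 𝒱 f n v = (n.factorial : K)⁻¹ • ∑ τ : Equiv.Perm (Fin n),
      koszulSign K p τ • (List.ofFn fun i => f (v (τ i))).prod := by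
  rw [symMultilinear_apply]
  congr 1
  refine Finset.sum_congr rfl fun τ _ => ?_
  rw [Finset.sum_eq_single p]
  · simp only [homPart_same 𝒱 (hv _)]
  · intro q _ hq
    obtain ⟨k, hk⟩ := Function.ne_iff.1 hq
    rw [prod_eq_zero_of_homPart 𝒱 f τ q (hv k) hk, smul_zero]
  · simp

theorem koszulSign_swap {n : ℕ} (p : Fin n → ZMod 2) (τ : Equiv.Perm (Fin n)) {k l : Fin n}
    (hkl : k.val + 1 = l.val) :
    koszulSign K (p ∘ Equiv.swap k l) (Equiv.swap k l * τ) =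
      sgn K (p k) (p l) * koszulSign K p τ := by
  classical
  set s := Equiv.swap k l with hs
  let g : Fin n → Fin n → K := fun a b => if p a = 1 ∧ p b = 1 ∧ τ⁻¹ b < τ⁻¹ a then -1 else 1
  let c : Fin n → Fin n → K := fun a b => if a = k ∧ b = l ∨ a = l ∧ b = k then g a b else 1
  have hne : k ≠ l := by rintro rfl; omega
  have h1 : koszulSign K (p ∘ s) (s * τ) = ∏ a, ∏ b, if s a < s b then g a b else 1 := by
    unfold koszulSign
    rw [← Equiv.prod_comp s]
    refine Finset.prod_congr rfl fun a _ => ?_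
    rw [← Equiv.prod_comp s]
    refine Finset.prod_congr rfl fun b _ => ?_
    simp only [g, hs, Function.comp_apply, Equiv.swap_apply_self, Equiv.swap_inv, mul_inv_rev,
      Equiv.Perm.mul_apply]
    split_ifs <;> tauto
  have h2 : koszulSign K p τ = ∏ a, ∏ b, if a < b then g a b else 1 := by
    unfold koszulSign
    refine Finset.prod_congr rfl fun a _ => Finset.prod_congr rfl fun b _ => ?_
    simp only [g]
    split_ifs <;> tauto
  have hgg : ∀ a b, g a b * g a b = 1 := by
    intro a b; simp only [g]; split_ifs <;> simp
  have hc : ∀ a b, (if s a < s b then g a b else 1) = c a b * (if a < b then g a b else 1) := by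
    intro a b
    by_cases hab : a = k ∧ b = l
    · obtain ⟨rfl, rfl⟩ := hab
      have h3 : ¬ b < a := by rw [Fin.lt_def]; omega
      have h4 : a < b := by rw [Fin.lt_def]; omega
      simp [c, hs, h3, h4, hgg]
    by_cases hba : a = l ∧ b = k
    · obtain ⟨rfl, rfl⟩ := hba
      have h3 : ¬ a < b := by rw [Fin.lt_def]; omega
      have h4 : b < a := by rw [Fin.lt_def]; omega
      simp [c, hs, h3, h4]
    have h5 : c a b = 1 := by simp only [c]; rw [if_neg (by tauto)]
    have h6 : s a < s b ↔ a < b := by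
      rw [hs, Equiv.swap_apply_def, Equiv.swap_apply_def]
      simp only [Fin.lt_def, Fin.ext_iff] at *
      split_ifs <;> omega
    simp [h5, h6]
  have hcp : ∏ a, ∏ b, c a b = sgn K (p k) (p l) := by
    rw [Finset.prod_eq_mul k l hne, Finset.prod_eq_single l, Finset.prod_eq_single k]
    · have hτ : τ⁻¹ k < τ⁻¹ l ↔ ¬ τ⁻¹ l < τ⁻¹ k := by
        have : τ⁻¹ k ≠ τ⁻¹ l := fun h => hne (τ⁻¹.injective h)
        constructor
        · exact fun h => not_lt.2 h.le
        · exact fun h => lt_of_le_of_ne (not_lt.1 h) this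
      have hz : ∀ i : ZMod 2, i = 0 ∨ i = 1 := by decide
      have hkl' : c k l = g k l := by simp [c]
      have hlk' : c l k = g l k := by simp [c]
      rw [hkl', hlk']
      rcases hz (p k) with h | h <;> rcases hz (p l) with h' | h' <;>
        simp only [g, h, h', sgn, hτ]
      · simp
      · simp
      · simp
      · by_cases hl : τ⁻¹ l < τ⁻¹ k
        · rw [if_pos ⟨trivial, trivial, hl⟩, if_neg (fun h => h.2.2 hl)]; simp [ZMod.val_one]
        · rw [if_neg (fun h => hl h.2.2), if_pos ⟨trivial, trivial, hl⟩]; simp [ZMod.val_one]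
    · intro b _ hb; simp [c, hb, hne.symm]
    · simp
    · intro b _ hb; simp [c, hb, hne]
    · simp
    · intro a _ ha; simp [c, ha.1, ha.2]
    · simp
    · simp
  rw [h1, h2, ← hcp, ← Finset.prod_mul_distrib]
  refine Finset.prod_congr rfl fun a _ => ?_
  rw [← Finset.prod_mul_distrib]
  exact Finset.prod_congr rfl fun b _ => hc a b

theorem symMultilinear_swap (f : V →ₗ[K] A) {n : ℕ} {v : Fin n → V} {k l : Fin n}
    (hkl : k.val + 1 = l.val) {i j : ZMod 2} (hk : v k ∈ 𝒱 i) (hl : v l ∈ 𝒱 j) :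
    symMultilinear 𝒱 f n (v ∘ Equiv.swap k l) = sgn K i j • symMultilinear 𝒱 f n v := by
  rw [symMultilinear_apply, symMultilinear_apply, smul_comm]
  congr 1
  rw [Finset.smul_sum, ← Equiv.sum_comp (Equiv.mulLeft (Equiv.swap k l))]
  refine Finset.sum_congr rfl fun τ _ => ?_
  rw [Finset.smul_sum, ← Equiv.sum_comp ((Equiv.swap k l).arrowCongr (Equiv.refl (ZMod 2)))]
  refine Finset.sum_congr rfl fun p _ => ?_
  have e : (Equiv.swap k l).arrowCongr (Equiv.refl (ZMod 2)) p = p ∘ Equiv.swap k l := by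
    ext; simp [Equiv.arrowCongr]
  simp only [e, Equiv.coe_mulLeft, Function.comp_apply, Equiv.Perm.mul_apply,
    Equiv.swap_apply_self]
  rw [koszulSign_swap p τ hkl]
  by_cases h : p k = i ∧ p l = j
  · rw [h.1, h.2, mul_smul]
  · have h0 : (List.ofFn fun i => f (homPart 𝒱 (p (τ i)) (v (τ i)))).prod = 0 := by
      by_cases h' : p k = i
      · exact prod_eq_zero_of_homPart 𝒱 f τ p hl fun h'' => h ⟨h', h''⟩
      · exact prod_eq_zero_of_homPart 𝒱 f τ p hk h'
    rw [h0]; simp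

/-- The symmetrisation before passing to the quotient: `v₁ ⊗ ⋯ ⊗ vₙ ↦ symMultilinear n v`. -/
noncomputable def symTensor (f : V →ₗ[K] A) : TensorAlgebra K V →ₗ[K] A :=
  DirectSum.toModule K ℕ A (fun n => PiTensorProduct.lift (symMultilinear 𝒱 f n)) ∘ₗ
    TensorAlgebra.equivDirectSum.toLinearMap

theorem symTensor_ofFn (f : V →ₗ[K] A) {n : ℕ} (v : Fin n → V) :
    symTensor 𝒱 f (List.ofFn fun i => TensorAlgebra.ι K (v i)).prod = symMultilinear 𝒱 f n v := by
  rw [← TensorAlgebra.tprod_apply]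
  simp only [symTensor, LinearMap.comp_apply, AlgEquiv.toLinearMap_apply,
    TensorAlgebra.equivDirectSum_apply, TensorAlgebra.toDirectSum_tensorPower_tprod]
  rw [← DirectSum.lof_eq_of K, DirectSum.toModule_lof, PiTensorProduct.lift.tprod]

theorem map_eq_ofFn {α β : Type*} (f : α → β) (l : List α) {n : ℕ} (h : l.length = n) :
    l.map f = List.ofFn fun m : Fin n => f (l[m.val]'(by omega)) :=
  List.ext_getElem (by simp [h]) (by intros; simp)

theorem symTensor_list (f : V →ₗ[K] A) (l₁ l₂ : List V) {i j : ZMod 2} {x y : V}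
    (hx : x ∈ 𝒱 i) (hy : y ∈ 𝒱 j) :
    symTensor 𝒱 f ((l₁ ++ x :: y :: l₂).map (TensorAlgebra.ι K)).prod =
      sgn K i j • symTensor 𝒱 f ((l₁ ++ y :: x :: l₂).map (TensorAlgebra.ι K)).prod := by
  set n := (l₁ ++ y :: x :: l₂).length with hn
  have hn' : (l₁ ++ x :: y :: l₂).length = n := by simp [hn]
  let v : Fin n → V := fun m => (l₁ ++ y :: x :: l₂)[m]
  let w : Fin n → V := fun m => (l₁ ++ x :: y :: l₂)[m.val]'(by omega)
  let k : Fin n := ⟨l₁.length, by simp [hn]⟩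
  let l : Fin n := ⟨l₁.length + 1, by simp [hn]⟩
  have hw : w = v ∘ Equiv.swap k l := by
    funext m
    simp only [w, v, Function.comp_apply, Equiv.swap_apply_def, k, l, Fin.ext_iff]
    grind
  have e1 : (l₁ ++ y :: x :: l₂).map (TensorAlgebra.ι K) =
      List.ofFn fun m => TensorAlgebra.ι K (v m) := by
    exact map_eq_ofFn _ _ hn.symm
  have e2 : (l₁ ++ x :: y :: l₂).map (TensorAlgebra.ι K) =
      List.ofFn fun m => TensorAlgebra.ι K (w m) := by
    exact map_eq_ofFn _ _ hn'
  rw [e1, e2, symTensor_ofFn, symTensor_ofFn, hw]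
  have hv1 : v k ∈ 𝒱 j := by simpa [v, k] using hy
  have hv2 : v l ∈ 𝒱 i := by simpa [v, l] using hx
  rw [symMultilinear_swap 𝒱 f (k := k) (l := l) rfl hv1 hv2]
  congr 1
  simp [sgn, mul_comm]

theorem tensor_induction {C : TensorAlgebra K V → Prop}
    (list : ∀ l : List V, C (l.map (TensorAlgebra.ι K)).prod)
    (add : ∀ a b, C a → C b → C (a + b)) (smul : ∀ (c : K) a, C a → C (c • a))
    (t : TensorAlgebra K V) : C t := by
  suffices h : ∀ b, (∀ l : List V, C ((l.map (TensorAlgebra.ι K)).prod * b)) →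
      ∀ l : List V, C ((l.map (TensorAlgebra.ι K)).prod * (t * b)) by
    simpa using h 1 (by simpa using list) []
  induction t using TensorAlgebra.induction with
  | algebraMap r =>
    intro b hb l
    rw [← Algebra.smul_def, mul_smul_comm]
    exact smul r _ (hb l)
  | ι x =>
    intro b hb l
    simpa [mul_assoc] using hb (l ++ [x])
  | mul x y hx hy =>
    intro b hb l
    rw [mul_assoc]
    exact hx _ (hy b hb) l
  | add x y hx hy =>
    intro b hb l
    rw [add_mul, mul_add]
    exact add _ _ (hx b hb l) (hy b hb l)

theorem symTensor_rel (f : V →ₗ[K] A) {a b : TensorAlgebra K V} (h : symCon 𝒱 a b) :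
    symTensor 𝒱 f a = symTensor 𝒱 f b := by
  let c : RingCon (TensorAlgebra K V) :=
    { r := fun a b => ∀ u w, symTensor 𝒱 f (u * a * w) = symTensor 𝒱 f (u * b * w)
      iseqv := ⟨fun _ _ _ => rfl, fun h u w => (h u w).symm,
        fun h h' u w => (h u w).trans (h' u w)⟩
      add' := by
        intro a b c d h h' u w
        simp only [mul_add, add_mul, map_add, h u w, h' u w]
      mul' := by
        intro a b c d h h' u w
        have h1 := h u (c * w)
        have h2 := h' (u * b) w
        simp only [mul_assoc] at h1 h2 ⊢
        rw [h1, h2] }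
  have hle : symCon 𝒱 ≤ c := by
    refine RingCon.ringConGen_le.2 ?_
    intro a b h
    induction h with
    | @comm i j x y hx hy =>
      intro u w
      induction u using tensor_induction with
      | list l₁ =>
        induction w using tensor_induction with
        | list l₂ =>
          have := symTensor_list 𝒱 f l₁ l₂ hx hy
          simpa [mul_assoc] using this
        | add a b ha hb => rw [mul_add, mul_add, map_add, map_add, ha, hb]
        | smul c a ha => rw [mul_smul_comm, mul_smul_comm, map_smul, map_smul, ha]
      | add a b ha hb => simp only [add_mul, map_add, ha, hb]
      | smul c a ha =>
        rw [smul_mul_assoc, smul_mul_assoc, smul_mul_assoc, smul_mul_assoc, map_smul, map_smul, ha]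
  simpa using hle h 1 1

/-- The symmetrisation map `σ : S(V) → A` along a linear map `f` from a super vector space `V` to
an associative algebra `A`. On homogeneous `v₁, …, vₙ ∈ V` it is given by
`σ(v₁ • ⋯ • vₙ) = 1/n! ∑_τ (-1)^{|τ|} f(v_{τ(1)}) ⋯ f(v_{τ(n)})`, see `symmetrisation_prod`. For an
even linear map `f` to a superalgebra `A` it is the composition of `S(f) : S(V) → S(A)` with the
symmetrisation map `S(A) → A`. -/
noncomputable def symmetrisation (f : V →ₗ[K] A) : SSym 𝒱 →ₗ[K] A where
  toFun := Quotient.lift (symTensor 𝒱 f) fun _ _ h => symTensor_rel 𝒱 f h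
  map_add' := by
    rintro ⟨a⟩ ⟨b⟩
    exact map_add (symTensor 𝒱 f) a b
  map_smul' := by
    rintro c ⟨a⟩
    exact map_smul (symTensor 𝒱 f) c a

theorem symmetrisation_prod (f : V →ₗ[K] A) {n : ℕ} {v : Fin n → V} {p : Fin n → ZMod 2}
    (hv : ∀ i, v i ∈ 𝒱 (p i)) :
    symmetrisation 𝒱 f (List.ofFn fun i => SSym.ι 𝒱 (v i)).prod =
      (n.factorial : K)⁻¹ • ∑ τ : Equiv.Perm (Fin n),
        koszulSign K p τ • (List.ofFn fun i => f (v (τ i))).prod := by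
  rw [← symMultilinear_of_mem 𝒱 f hv, ← symTensor_ofFn]
  have h : (List.ofFn fun i => SSym.ι 𝒱 (v i)).prod =
      RingCon.mkₐ K (symCon 𝒱) (List.ofFn fun i => TensorAlgebra.ι K (v i)).prod := by
    rw [map_list_prod, List.map_ofFn]
    rfl
  rw [h]
  rfl

end Symmetrisation

/-- The structure of a Lie superalgebra on a super vector space `𝔤 0 ⊕ 𝔤 1`. -/
structure LieSuperalgebra {K g : Type*} [Field K] [AddCommGroup g] [Module K g]
    (𝔤 : ZMod 2 → Submodule K g) where
  /-- The superbracket `[x, y]`. -/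
  bracket : g →ₗ[K] g →ₗ[K] g
  bracket_mem : ∀ {i j : ZMod 2} {x y : g}, x ∈ 𝔤 i → y ∈ 𝔤 j → bracket x y ∈ 𝔤 (i + j)
  bracket_skew : ∀ {i j : ZMod 2} {x y : g}, x ∈ 𝔤 i → y ∈ 𝔤 j →
    bracket x y = -(sgn K i j • bracket y x)
  jacobi : ∀ {i j k : ZMod 2} {x y z : g}, x ∈ 𝔤 i → y ∈ 𝔤 j → z ∈ 𝔤 k →
    bracket x (bracket y z) = bracket (bracket x y) z + sgn K i j • bracket y (bracket x z)

namespace LieSuperalgebra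

variable {K g : Type*} [Field K] [AddCommGroup g] [Module K g]
variable {𝔤 : ZMod 2 → Submodule K g} (L : LieSuperalgebra 𝔤)

/-- The defining relations `[x, y] = x y - (-1)^{|x||y|} y x`, for homogeneous `x, y`, of the
universal enveloping algebra. -/
inductive EnvRel : TensorAlgebra K g → TensorAlgebra K g → Prop
  | lie {i j : ZMod 2} {x y : g} (hx : x ∈ 𝔤 i) (hy : y ∈ 𝔤 j) :
      EnvRel (TensorAlgebra.ι K (L.bracket x y))
        (TensorAlgebra.ι K x * TensorAlgebra.ι K y -
          sgn K i j • (TensorAlgebra.ι K y * TensorAlgebra.ι K x))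

/-- The ring congruence generated by `EnvRel`. -/
def envCon : RingCon (TensorAlgebra K g) := ringConGen L.EnvRel

/-- The universal enveloping algebra `U(g)`. -/
abbrev Env := L.envCon.Quotient

/-- The canonical map `g → U(g)`. -/
def ι : g →ₗ[K] L.Env := (RingCon.mkₐ K L.envCon).toLinearMap ∘ₗ TensorAlgebra.ι K

/-- The linear map `Z ↦ ad~_Z`, where `ad~_Z` is the operator `Y ↦ [Y, Z]` on `g`. -/
def adTilde : g →ₗ[K] Module.End K g := L.bracket.flip

/-- `ad~_Z` has the parity of `Z`. -/
theorem adTilde_mem {i j : ZMod 2} {z y : g} (hz : z ∈ 𝔤 i) (hy : y ∈ 𝔤 j) :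
    L.adTilde z y ∈ 𝔤 (i + j) :=
  add_comm j i ▸ L.bracket_mem hy hz

variable [DirectSum.Decomposition 𝔤]

/-- The symmetrisation map `σ : S(g) → U(g)`. -/
noncomputable def sym : SSym 𝔤 →ₗ[K] L.Env := symmetrisation 𝔤 L.ι

/-- The operator `π(X) : Y ↦ σ⁻¹(X σ(Y))` on `S(g)`, for a bijective `σ`. -/
noncomputable def leftAction (hσ : Function.Bijective L.sym) (X : g) : Module.End K (SSym 𝔤) :=
  (LinearEquiv.ofBijective L.sym hσ).symm.toLinearMap ∘ₗ LinearMap.mulLeft K (L.ι X) ∘ₗ L.sym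

end LieSuperalgebra

/-- The multi-indices `ℕ^{m|n} = ℕ^m × {0,1}^n`. -/
abbrev MultiIndex (m n : ℕ) := (Fin m → ℕ) × (Fin n → Fin 2)

namespace MultiIndex

variable {m n : ℕ} (k : MultiIndex m n)

/-- The length `|K| = ∑ k_i`. -/
def length : ℕ := ∑ i, k.1 i + ∑ j, (k.2 j : ℕ)

/-- The factorial `K! = k_1! ⋯ k_m!`. -/
def factorial : ℕ := ∏ i, (k.1 i).factorial

/-- The ordered monomial `a_1^{k_1} ⋯ a_{m+n}^{k_{m+n}}` in a monoid. -/
def monomial {M : Type*} [Monoid M] (a : Fin m ⊕ Fin n → M) : M :=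
  (List.ofFn fun i => a (Sum.inl i) ^ k.1 i).prod *
    (List.ofFn fun j => a (Sum.inr j) ^ (k.2 j : ℕ)).prod

end MultiIndex

section Basis

variable {K g : Type*} [Field K] [AddCommGroup g] [Module K g]
variable {𝔤 : ZMod 2 → Submodule K g} [DirectSum.Decomposition 𝔤]
variable {m n : ℕ} (b : Module.Basis (Fin m ⊕ Fin n) K g)

/-- The operator `∂^K = (∂^1)^{k_1} ⋯ (∂^{m+n})^{k_{m+n}}` on `S(g)`, with `∂^i` the super
derivation such that `∂^i X_j = δ_{ij}`. -/
noncomputable def partialK (𝔤 : ZMod 2 → Submodule K g) [DirectSum.Decomposition 𝔤]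
    (k : MultiIndex m n) : Module.End K (SSym 𝔤) :=
  k.monomial fun i => pderiv 𝔤 (b.coord i)

/-- The operator `s^K = σ(ad~_{X_1}^{k_1} • ⋯ • ad~_{X_{m+n}}^{k_{m+n}})` on `g`, with `σ` the
symmetrisation along `X ↦ ad~_X` with values in the algebra `End(g)`. -/
noncomputable def sOp (L : LieSuperalgebra 𝔤) (k : MultiIndex m n) : Module.End K g :=
  symmetrisation 𝔤 L.adTilde (k.monomial fun i => SSym.ι 𝔤 (b i))

end Basis

end SuperLie

/-! The operator Y ↦ σ⁻¹(X σ(Y)) makes sense only once σ is known to be bijective, so the formula is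
first studied as an action in its own right. On g ⊗ S(g) let D = ∑ ad~_{X_i} ⊗ ∂^i, let μ be the
multiplication, and put π(x)y = ∑ c_r μ(D^r(x ⊗ y)), where ∑ c_r t^r = t e^t/(e^t − 1), that is c_r
= (−1)^r B_r / r! (`seriesAction`). If π represents g (`seriesAction_bracket`), it extends to U(g),
and u ↦ π(u)1 is a linear map U(g) → S(g) (`envEval`) which turns out to invert σ.

Signs are removed by extending coefficients. For a supercommutative algebra Λ, an even element z of
Λ ⊗ g behaves like an element of an ordinary Lie algebra: symmetrisation sends z^n to z^n
(`symmetrisation_pow`), the bracket is skew with ad_z a derivation, and D^r(w ⊗ z^n) = n!/(n−r)! ·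
ad_z^r w ⊗ z^{n−r} (`lTensor_adDeriv_pow_pow`). With Λ a Grassmann algebra on infinitely many
generators, such powers detect every linear map on S(g) (`eq_zero_of_evenPoints`).

In the commutator of π(u) and π(w) on z^n, the part without a bracket of u with w is symmetric and
cancels. The rest is a combination of the elements [ad_z^i u, ad_z^j w]. Encode them as s^i t^j;
then s + t stands for ad_z, and the required relation is a functional equation of t e^t/(e^t − 1)
(`bernoulli_identity`).

Since [z, z] = 0 one has π(z)z^n = z^{n+1}, so `envEval` takes σ(z^n) to z^n and σ is injective,
without appeal to Poincaré–Birkhoff–Witt. Surjectivity holds because U(g) is supercommutative modulo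
shorter products. Hence σ⁻¹ is `envEval` and transports left multiplication to π. Finally, the
multinomial theorem for z = ∑ ζ_i ⊗ X_i splits ad_z^r into the operators s^K, and comparison with
∂^K z^N gives the sum over multi-indices. -/

namespace SuperLie

/-! ### Koszul signs of permutations -/

section Koszul

variable {K : Type*} [Field K]

theorem sgn_comm (i j : ZMod 2) : sgn K i j = sgn K j i := by simp [sgn, mul_comm]

theorem sgn_mul_self (i j : ZMod 2) : sgn K i j * sgn K i j = 1 := by
  rw [sgn, ← mul_pow]; simp

theorem sgn_zero_left (i : ZMod 2) : sgn K 0 i = 1 := by simp [sgn]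

theorem sgn_zero_right (i : ZMod 2) : sgn K i 0 = 1 := by simp [sgn]

theorem sgn_one_one : sgn K 1 1 = -1 := by simp [sgn, ZMod.val_one]

theorem zmod_two_eq (i : ZMod 2) : i = 0 ∨ i = 1 := by revert i; decide

theorem koszulSign_one {n : ℕ} (p : Fin n → ZMod 2) : koszulSign K p 1 = 1 := by
  unfold koszulSign
  refine Finset.prod_eq_one fun i _ => Finset.prod_eq_one fun j _ => ?_
  rw [if_neg]
  rintro ⟨h1, -, -, h2⟩
  exact lt_asymm h1 (by simpa using h2)

/-- A function of `n` homogeneous objects which changes by the Koszul sign under exchange of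
neighbours changes by the Koszul sign under all permutations. -/
theorem koszulSign_smul_comp {M X : Type*} [AddCommGroup M] [Module K M] {n : ℕ}
    (R : ZMod 2 → X → Prop) (Φ : (Fin n → X) → M)
    (hΦ : ∀ (p : Fin n → ZMod 2) (v : Fin n → X), (∀ i, R (p i) (v i)) → ∀ k l : Fin n,
      k.val + 1 = l.val → Φ (v ∘ Equiv.swap k l) = sgn K (p k) (p l) • Φ v)
    (τ : Equiv.Perm (Fin n)) (p : Fin n → ZMod 2) (v : Fin n → X) (hv : ∀ i, R (p i) (v i)) :
    koszulSign K p τ • Φ (v ∘ τ) = Φ v := by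
  cases n with
  | zero =>
    rw [Subsingleton.elim τ 1, koszulSign_one, one_smul]
    rfl
  | succ n =>
    have hτ : τ ∈ Submonoid.closure
        (Set.range fun i : Fin n => Equiv.swap i.castSucc i.succ) := by
      rw [Equiv.Perm.mclosure_swap_castSucc_succ]; trivial
    -- Neighbour transpositions generate the symmetric group. Splitting one off permutes the
    -- parities and the objects together, so both must vary in the induction.
    induction hτ using Submonoid.closure_induction_left generalizing p v with
    | one => rw [koszulSign_one, one_smul]; rfl
    | mul_left s hs τ _ ih =>
      obtain ⟨i, rfl⟩ := hs
      have h := koszulSign_swap (K := K) (p ∘ Equiv.swap i.castSucc i.succ) τ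
        (k := i.castSucc) (l := i.succ) (by simp)
      have hp : (p ∘ Equiv.swap i.castSucc i.succ) ∘ Equiv.swap i.castSucc i.succ = p := by
        ext; simp
      rw [hp] at h
      have ih' := ih (p ∘ Equiv.swap i.castSucc i.succ) (v ∘ Equiv.swap i.castSucc i.succ)
        (fun j => hv _)
      rw [hΦ p v hv _ _ (by simp)] at ih'
      rw [h, mul_smul, Equiv.Perm.coe_mul, ← Function.comp_assoc, ih', smul_smul]
      simp [sgn_comm (p i.succ), sgn_mul_self]

theorem exists_ofFn_eq_append {X : Type*} {n : ℕ} (v : Fin n → X) {k l : Fin n}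
    (hkl : k.val + 1 = l.val) : ∃ l₁ l₂ : List X, l₁.length + l₂.length + 2 = n ∧
      List.ofFn v = l₁ ++ v k :: v l :: l₂ ∧
      List.ofFn (v ∘ Equiv.swap k l) = l₁ ++ v l :: v k :: l₂ := by
  refine ⟨(List.ofFn v).take k, (List.ofFn v).drop (k + 2), ?_, ?_, ?_⟩
  · simp; omega
  · apply List.ext_getElem
    · simp; omega
    · intro i h1 h2
      simp only [List.getElem_ofFn, List.getElem_append, List.getElem_cons, List.length_take,
        List.length_ofFn, List.getElem_take, List.getElem_drop]
      split_ifs <;> congr 1 <;> ext <;> simp <;> omega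
  · apply List.ext_getElem
    · simp; omega
    · intro i h1 h2
      simp only [List.getElem_ofFn, List.getElem_append, List.getElem_cons, List.length_take,
        List.length_ofFn, List.getElem_take, List.getElem_drop, Function.comp_apply,
        Equiv.swap_apply_def, Fin.ext_iff]
      split_ifs <;> first | omega | (congr 1 <;> ext <;> simp <;> omega)

/-- Products of supercommuting elements. -/
theorem koszulSign_smul_prod {A X : Type*} [Ring A] [Algebra K A] (p : X → ZMod 2) (e : X → A)
    (he : ∀ i j, e i * e j = sgn K (p i) (p j) • (e j * e i)) {n : ℕ} (τ : Equiv.Perm (Fin n))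
    (κ : Fin n → X) :
    koszulSign K (p ∘ κ) τ • (List.ofFn fun j => e (κ (τ j))).prod =
      (List.ofFn fun j => e (κ j)).prod := by
  refine koszulSign_smul_comp (R := fun i x => p x = i)
    (Φ := fun κ : Fin n → X => (List.ofFn fun j => e (κ j)).prod) ?_ τ (p ∘ κ) κ (fun _ => rfl)
  intro q v hv k l hkl
  obtain ⟨l₁, l₂, -, h1, h2⟩ := exists_ofFn_eq_append v hkl
  have hm : ∀ w : Fin n → X, (List.ofFn fun j => e (w j)) = (List.ofFn w).map e := by
    intro w; rw [List.map_ofFn]; rfl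
  simp only [hm, h1, h2, List.map_append, List.map_cons, List.prod_append, List.prod_cons]
  rw [← mul_assoc (e (v l)), he (v l) (v k), hv, hv, sgn_comm]
  simp [mul_assoc]

end Koszul

open scoped TensorProduct

/-! ### Symmetrisation of powers of even points -/

section Power

theorem prod_ofFn_tmul {K A B : Type*} [Field K] [Ring A] [Algebra K A] [Ring B] [Algebra K B] {n : ℕ} (e : Fin n → A)
    (a : Fin n → B) : (List.ofFn fun j => e j ⊗ₜ[K] a j).prod =
      (List.ofFn e).prod ⊗ₜ[K] (List.ofFn a).prod := by
  induction n with
  | zero => simp [Algebra.TensorProduct.one_def]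
  | succ n ih => simp [List.ofFn_succ, ih]

variable {K V A : Type*} [Field K] [CharZero K] [AddCommGroup V] [Module K V] [Ring A]
  [Algebra K A]
variable (𝒱 : ZMod 2 → Submodule K V) [DirectSum.Decomposition 𝒱]

theorem sum_pow_eq_sum_ofFn {R X : Type*} [Ring R] [Fintype X] (z : X → R)
    (n : ℕ) : (∑ i, z i) ^ n = ∑ κ : Fin n → X, (List.ofFn fun j => z (κ j)).prod := by
  induction n with
  | zero => simp
  | succ n ih =>
    rw [pow_succ', ih, ← (Fin.consEquiv fun _ => X).sum_comp, Fintype.sum_prod_type,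
      Finset.sum_mul_sum]
    simp [Fin.consEquiv, List.ofFn_succ]

/-- The symmetrisation along `f` maps powers of even points to powers. -/
theorem symmetrisation_pow {Λ X : Type*} [Ring Λ] [Algebra K Λ] [Fintype X] (f : V →ₗ[K] A)
    (p : X → ZMod 2) (e : X → Λ) (he : ∀ i j, e i * e j = sgn K (p i) (p j) • (e j * e i))
    (v : X → V) (hv : ∀ i, v i ∈ 𝒱 (p i)) (n : ℕ) :
    (symmetrisation 𝒱 f).lTensor Λ ((∑ i, e i ⊗ₜ[K] SSym.ι 𝒱 (v i)) ^ n) =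
      (∑ i, e i ⊗ₜ[K] f (v i)) ^ n := by
  rw [sum_pow_eq_sum_ofFn, sum_pow_eq_sum_ofFn, map_sum]
  have h1 : ∀ κ : Fin n → X, (symmetrisation 𝒱 f).lTensor Λ
      (List.ofFn fun j => e (κ j) ⊗ₜ[K] SSym.ι 𝒱 (v (κ j))).prod =
      (n.factorial : K)⁻¹ • ∑ τ : Equiv.Perm (Fin n),
        (List.ofFn fun j => e (κ (τ j)) ⊗ₜ[K] f (v (κ (τ j)))).prod := by
    intro κ
    rw [prod_ofFn_tmul, LinearMap.lTensor_tmul,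
      symmetrisation_prod 𝒱 f (p := p ∘ κ) (fun i => hv (κ i)), TensorProduct.tmul_smul,
      TensorProduct.tmul_sum]
    congr 1
    refine Finset.sum_congr rfl fun τ _ => ?_
    -- Reordering the coefficients `e` by `τ` costs the same Koszul sign that the symmetrisation
    -- carries, and the two signs cancel.
    rw [prod_ofFn_tmul, TensorProduct.tmul_smul, TensorProduct.smul_tmul',
      ← koszulSign_smul_prod p e he τ κ, smul_smul]
    congr 2
    have h : koszulSign K (p ∘ κ) τ * koszulSign K (p ∘ κ) τ = 1 := by
      unfold koszulSign
      simp only [← Finset.prod_mul_distrib]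
      refine Finset.prod_eq_one fun i _ => Finset.prod_eq_one fun j _ => ?_
      split_ifs <;> simp
    rw [h, one_smul]
  simp only [h1]
  rw [← Finset.smul_sum, Finset.sum_comm]
  -- Precomposing `κ` with `τ` permutes the summands, so every permutation contributes the same
  -- total and the factor 1/n! is used up.
  have h2 : ∀ τ : Equiv.Perm (Fin n), ∑ κ : Fin n → X,
      (List.ofFn fun j => e (κ (τ j)) ⊗ₜ[K] f (v (κ (τ j)))).prod =
      ∑ κ : Fin n → X, (List.ofFn fun j => e (κ j) ⊗ₜ[K] f (v (κ j))).prod := by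
    intro τ
    exact (τ.symm.arrowCongr (Equiv.refl X)).sum_comp
      (fun κ : Fin n → X => (List.ofFn fun j => e (κ j) ⊗ₜ[K] f (v (κ j))).prod)
  simp only [h2]
  rw [Finset.sum_const, Finset.card_univ, Fintype.card_perm, Fintype.card_fin,
    ← Nat.cast_smul_eq_nsmul K, smul_smul, inv_mul_cancel₀, one_smul]
  exact_mod_cast n.factorial_ne_zero

end Power

/-! ### The enveloping algebra and surjectivity of σ -/

namespace LieSuperalgebra

variable {K g : Type*} [Field K] [AddCommGroup g] [Module K g]
variable {𝔤 : ZMod 2 → Submodule K g} (L : LieSuperalgebra 𝔤)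

theorem ι_bracket {i j : ZMod 2} {x y : g} (hx : x ∈ 𝔤 i) (hy : y ∈ 𝔤 j) :
    L.ι (L.bracket x y) = L.ι x * L.ι y - sgn K i j • (L.ι y * L.ι x) := by
  have h : L.envCon _ _ := RingCon.le_ringConGen _ _ (EnvRel.lie hx hy)
  exact Quotient.sound h

theorem env_induction {C : L.Env → Prop} (one : C 1)
    (ι_mul : ∀ x a, C a → C (L.ι x * a)) (add : ∀ a b, C a → C b → C (a + b))
    (smul : ∀ (c : K) a, C a → C (c • a)) (a : L.Env) : C a := by
  obtain ⟨t, rfl⟩ := RingCon.mkₐ_surjective (α := K) L.envCon a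
  suffices h : ∀ b, C b → C (RingCon.mkₐ K L.envCon t * b) by simpa using h 1 one
  induction t using TensorAlgebra.induction with
  | algebraMap r => intro b hb; simpa [← Algebra.smul_def] using smul r b hb
  | ι x => intro b hb; exact ι_mul x b hb
  | mul x y hx hy => intro b hb; rw [map_mul, mul_assoc]; exact hx _ (hy _ hb)
  | add x y hx hy => intro b hb; rw [map_add, add_mul]; exact add _ _ (hx _ hb) (hy _ hb)

/-- The universal property of the enveloping algebra. -/
def envLift {A : Type*} [Ring A] [Algebra K A] (f : g →ₗ[K] A)
    (hf : ∀ (i j : ZMod 2) (x y : g), x ∈ 𝔤 i → y ∈ 𝔤 j →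
      f (L.bracket x y) = f x * f y - sgn K i j • (f y * f x)) : L.Env →ₐ[K] A :=
  RingCon.liftₐ L.envCon (TensorAlgebra.lift K f) (by
    refine RingCon.ringConGen_le.2 ?_
    intro a b h
    induction h with
    | lie hx hy =>
      rw [RingCon.ker_apply]
      simpa using hf _ _ _ _ hx hy)

theorem envLift_ι {A : Type*} [Ring A] [Algebra K A] (f : g →ₗ[K] A)
    (hf : ∀ (i j : ZMod 2) (x y : g), x ∈ 𝔤 i → y ∈ 𝔤 j →
      f (L.bracket x y) = f x * f y - sgn K i j • (f y * f x)) (x : g) :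
    L.envLift f hf (L.ι x) = f x :=
  TensorAlgebra.lift_ι_apply (R := K) f x

/-- The span of the products of at most `n` homogeneous elements of `g`. -/
def envFiltration (n : ℕ) : Submodule K L.Env :=
  Submodule.span K {u | ∃ l : List g, l.length ≤ n ∧ (∀ x ∈ l, ∃ i, x ∈ 𝔤 i) ∧
    u = (l.map L.ι).prod}

theorem envFiltration_mono {n m : ℕ} (h : n ≤ m) : L.envFiltration n ≤ L.envFiltration m := by
  refine Submodule.span_mono ?_
  rintro u ⟨l, hl, hl', rfl⟩
  exact ⟨l, hl.trans h, hl', rfl⟩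

theorem prod_mem_envFiltration {l : List g} {n : ℕ} (hn : l.length ≤ n)
    (hl : ∀ x ∈ l, ∃ i, x ∈ 𝔤 i) : (l.map L.ι).prod ∈ L.envFiltration n :=
  Submodule.subset_span ⟨l, hn, hl, rfl⟩

theorem ι_mul_mem_envFiltration {x : g} {i : ZMod 2} (hx : x ∈ 𝔤 i) {n : ℕ} {u : L.Env}
    (hu : u ∈ L.envFiltration n) : L.ι x * u ∈ L.envFiltration (n + 1) := by
  induction hu using Submodule.span_induction with
  | mem u hu =>
    obtain ⟨l, hl, hl', rfl⟩ := hu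
    have : L.ι x * (l.map L.ι).prod = ((x :: l).map L.ι).prod := by simp
    rw [this]
    refine L.prod_mem_envFiltration (by simpa using hl) ?_
    intro y hy
    rcases List.mem_cons.1 hy with rfl | hy
    · exact ⟨i, hx⟩
    · exact hl' y hy
  | zero => simp
  | add u v _ _ hu hv => rw [mul_add]; exact add_mem hu hv
  | smul c u _ hu => rw [mul_smul_comm]; exact Submodule.smul_mem _ c hu

/-- Exchanging two neighbours leaves an error in which the pair is replaced by its bracket. That
product has one factor fewer, so it dies in the quotient. -/
theorem koszulSign_smul_mk_prod {n : ℕ} (τ : Equiv.Perm (Fin (n + 1)))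
    (p : Fin (n + 1) → ZMod 2) (v : Fin (n + 1) → g) (hv : ∀ i, v i ∈ 𝔤 (p i)) :
    koszulSign K p τ • (L.envFiltration n).mkQ (List.ofFn fun j => L.ι (v (τ j))).prod =
      (L.envFiltration n).mkQ (List.ofFn fun j => L.ι (v j)).prod := by
  refine koszulSign_smul_comp (R := fun i x => x ∈ 𝔤 i) (Φ := fun v : Fin (n + 1) → g =>
    (L.envFiltration n).mkQ (List.ofFn fun j => L.ι (v j)).prod) ?_ τ p v hv
  intro q v hv k l hkl
  obtain ⟨l₁, l₂, hlen, h1, h2⟩ := exists_ofFn_eq_append v hkl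
  have hhom : ∀ x ∈ l₁ ++ l₂, ∃ i, x ∈ 𝔤 i := by
    intro x hx
    have : x ∈ List.ofFn v := by
      rw [h1]
      simp only [List.mem_append, List.mem_cons] at hx ⊢
      tauto
    obtain ⟨i, rfl⟩ := (List.mem_ofFn' v x).1 this
    exact ⟨_, hv i⟩
  have hm : ∀ w : Fin (n + 1) → g, (List.ofFn fun j => L.ι (w j)) = (List.ofFn w).map L.ι := by
    intro w; rw [List.map_ofFn]; rfl
  rw [← map_smul, ← sub_eq_zero, ← map_sub, Submodule.mkQ_apply, Submodule.Quotient.mk_eq_zero,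
    hm, hm, h1, h2]
  have h3 : ((l₁ ++ v l :: v k :: l₂).map L.ι).prod -
      sgn K (q k) (q l) • ((l₁ ++ v k :: v l :: l₂).map L.ι).prod =
      ((l₁ ++ L.bracket (v l) (v k) :: l₂).map L.ι).prod := by
    simp only [List.map_append, List.map_cons, List.prod_append, List.prod_cons,
      L.ι_bracket (hv l) (hv k), sgn_comm (q k)]
    simp only [← mul_assoc, mul_sub, sub_mul, mul_smul_comm, smul_mul_assoc]
  rw [h3]
  refine L.prod_mem_envFiltration (by simp; omega) ?_
  intro x hx
  simp only [List.mem_append, List.mem_cons] at hx hhom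
  rcases hx with hx | rfl | hx
  · exact hhom x (Or.inl hx)
  · exact ⟨_, L.bracket_mem (hv l) (hv k)⟩
  · exact hhom x (Or.inr hx)

variable [DirectSum.Decomposition 𝔤]

theorem mem_envFiltration (u : L.Env) : ∃ n, u ∈ L.envFiltration n := by
  induction u using L.env_induction with
  | one => exact ⟨0, by simpa using L.prod_mem_envFiltration (l := []) le_rfl (by simp)⟩
  | ι_mul x a ha =>
    obtain ⟨n, hn⟩ := ha
    refine ⟨n + 1, ?_⟩
    rw [← homPart_add 𝔤 x, map_add, add_mul]
    exact add_mem (L.ι_mul_mem_envFiltration (homPart_mem 𝔤 0 x) hn)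
      (L.ι_mul_mem_envFiltration (homPart_mem 𝔤 1 x) hn)
  | add a b ha hb =>
    obtain ⟨n, hn⟩ := ha
    obtain ⟨m, hm⟩ := hb
    exact ⟨max n m, add_mem (L.envFiltration_mono (le_max_left _ _) hn)
      (L.envFiltration_mono (le_max_right _ _) hm)⟩
  | smul c a ha =>
    obtain ⟨n, hn⟩ := ha
    exact ⟨n, Submodule.smul_mem _ c hn⟩

variable [CharZero K]

/-- Modulo shorter products all terms of the symmetrisation coincide with the product itself. So σ
reaches each product up to shorter ones, which the induction covers. -/
theorem envFiltration_le_range_sym (n : ℕ) : L.envFiltration n ≤ LinearMap.range L.sym := by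
  induction n with
  | zero =>
    refine Submodule.span_le.2 ?_
    rintro u ⟨l, hl, -, rfl⟩
    rw [List.length_eq_zero_iff.1 (by omega : l.length = 0)]
    refine ⟨1, ?_⟩
    have := symmetrisation_prod 𝔤 L.ι (n := 0) (v := ![]) (p := ![]) (by simp)
    simpa [koszulSign_one, sym, Subsingleton.elim (default : Equiv.Perm (Fin 0)) 1] using this
  | succ n ih =>
    refine Submodule.span_le.2 ?_
    rintro u ⟨l, hl, hl', rfl⟩
    rcases Nat.lt_or_ge l.length (n + 1) with h | h
    · exact ih (L.prod_mem_envFiltration (by omega) hl')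
    obtain ⟨v, rfl⟩ : ∃ v : Fin (n + 1) → g, l = List.ofFn v := by
      have h' : l.length = n + 1 := by omega
      refine ⟨fun i => l[i.val]'(by omega), ?_⟩
      rw [← map_eq_ofFn (fun x => x) l h']; simp
    have : ∀ i, ∃ p, v i ∈ 𝔤 p := fun i => hl' _ ((List.mem_ofFn' v _).2 ⟨i, rfl⟩)
    choose p hp using this
    have h1 := symmetrisation_prod 𝔤 L.ι hp
    have h2 : (L.envFiltration n).mkQ (List.ofFn fun i => L.ι (v i)).prod =
        (L.envFiltration n).mkQ (L.sym (List.ofFn fun i => SSym.ι 𝔤 (v i)).prod) := by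
      rw [sym, h1, map_smul, map_sum]
      simp only [map_smul, L.koszulSign_smul_mk_prod _ p v hp]
      rw [Finset.sum_const, Finset.card_univ, Fintype.card_perm, Fintype.card_fin,
        ← Nat.cast_smul_eq_nsmul K, smul_smul, inv_mul_cancel₀, one_smul]
      exact_mod_cast (n + 1).factorial_ne_zero
    rw [← sub_eq_zero, ← map_sub, Submodule.mkQ_apply, Submodule.Quotient.mk_eq_zero] at h2
    have h3 := add_mem (ih h2)
      (LinearMap.mem_range_self L.sym (List.ofFn fun i => SSym.ι 𝔤 (v i)).prod)
    rw [sub_add_cancel] at h3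
    rw [List.map_ofFn]
    exact h3

theorem sym_surjective : Function.Surjective L.sym := by
  intro u
  obtain ⟨n, hn⟩ := L.mem_envFiltration u
  exact L.envFiltration_le_range_sym n hn

end LieSuperalgebra

/-! ### The functional equation behind the Bernoulli numbers -/

section Bernoulli

-- For b(t) = tX e^{tX}/(e^{tX} − 1) this is a consequence of e^{sX} e^{tX} = e^{(s+t)X}. After
-- multiplication by the three denominators, which are nonzero because s, t and s + t are, it
-- becomes a polynomial identity in e^{sX} and e^{tX}.
open PowerSeries in
theorem bernoulli_functional_equation {R : Type*} [CommRing R] [IsDomain R] [Algebra ℚ R]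
    {s t : R} (hs : s ≠ 0) (ht : t ≠ 0) (hst : s + t ≠ 0) :
    C s * (rescale t (bernoulli'PowerSeries R) * (rescale (s + t) (bernoulli'PowerSeries R) -
        rescale s (bernoulli'PowerSeries R))) +
      C t * (rescale s (bernoulli'PowerSeries R) * (rescale (s + t) (bernoulli'PowerSeries R) -
        rescale t (bernoulli'PowerSeries R))) =
      X * (C (s * t) * rescale (s + t) (bernoulli'PowerSeries R)) := by
  have hb : ∀ a : R, rescale a (bernoulli'PowerSeries R) * (rescale a (exp R) - 1) =
      C a * X * rescale a (exp R) := by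
    intro a
    have := congrArg (rescale a) (bernoulli'PowerSeries_mul_exp_sub_one R)
    simpa [rescale_X] using this
  have hne : ∀ a : R, a ≠ 0 → rescale a (exp R) - 1 ≠ 0 := by
    intro a ha h
    have := congrArg (coeff 1) h
    simp [coeff_one, coeff_rescale, coeff_exp, ha] at this
  have h1 := hb s
  have h2 := hb t
  have h3 := hb (s + t)
  have n1 := hne s hs
  have n2 := hne t ht
  have n3 := hne _ hst
  rw [← exp_mul_exp_eq_exp_add s t] at h3 n3
  generalize rescale s (exp R) = x at *
  generalize rescale t (exp R) = y at *
  generalize rescale (s + t) (bernoulli'PowerSeries R) = c at *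
  generalize rescale s (bernoulli'PowerSeries R) = a at *
  generalize rescale t (bernoulli'PowerSeries R) = b at *
  rw [map_add] at h3
  rw [map_mul]
  refine mul_right_cancel₀ (mul_ne_zero (mul_ne_zero n1 n2) n3) ?_
  have e : ∀ a' b' c' : PowerSeries R, a * (x - 1) = a' → b * (y - 1) = b' →
      c * (x * y - 1) = c' →
      (C s * (b * (c - a)) + C t * (a * (c - b))) * ((x - 1) * (y - 1) * (x * y - 1)) =
        C s * (b' * (c' * (x - 1) - a' * (x * y - 1))) +
          C t * (a' * (c' * (y - 1) - b' * (x * y - 1))) := by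
    rintro a' b' c' rfl rfl rfl
    ring
  rw [e _ _ _ h1 h2 h3]
  -- Of the three series only `c` is left, on the right-hand side; `h3` eliminates it.
  linear_combination (-(X * C s * C t) * (x - 1) * (y - 1)) * h3

-- This is the coefficient of X^{N+1} in the functional equation, divided by st. The differences
-- (s+t)^{q+1} − s^{q+1} with q = N − k are divisible by t as geometric sums, which produces the
-- inner sum over `a`.
open PowerSeries in
theorem bernoulli_identity {R : Type*} [CommRing R] [IsDomain R] [Algebra ℚ R]
    {s t : R} (hs : s ≠ 0) (ht : t ≠ 0) (hst : s + t ≠ 0) {c : ℕ → R}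
    (hc : ∀ r, c r = algebraMap ℚ R (bernoulli' r / r.factorial)) (N : ℕ) :
    ∑ k ∈ Finset.range (N + 1), ∑ a ∈ Finset.range (N - k + 1), c k * c (N - k + 1) *
      ((s + t) ^ (N - k - a) * (s ^ a * t ^ k) + (s + t) ^ (N - k - a) * (s ^ k * t ^ a)) =
    c N * (s + t) ^ N := by
  have hco : ∀ a r, coeff r (rescale a (bernoulli'PowerSeries R)) = c r * a ^ r := by
    intro a r
    rw [coeff_rescale, bernoulli'PowerSeries, coeff_mk, hc, mul_comm]
  have h := congrArg (coeff (N + 1)) (bernoulli_functional_equation hs ht hst)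
  rw [coeff_succ_X_mul, map_add, coeff_C_mul, coeff_C_mul, coeff_C_mul, coeff_mul, coeff_mul,
    Finset.Nat.sum_antidiagonal_eq_sum_range_succ_mk,
    Finset.Nat.sum_antidiagonal_eq_sum_range_succ_mk, Finset.sum_range_succ,
    Finset.sum_range_succ _ (N + 1)] at h
  -- The term k = N + 1 vanishes: it contains the constant coefficient of a difference of rescalings
  -- of one series.
  simp only [map_sub, hco, Nat.sub_self, pow_zero, sub_self, mul_zero, add_zero] at h
  have hgeom : ∀ (s t : R) (q : ℕ), (∑ a ∈ Finset.range (q + 1), (s + t) ^ (q - a) * s ^ a) * t =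
      (s + t) ^ (q + 1) - s ^ (q + 1) := by
    intro s t q
    have := geom_sum₂_mul s (s + t) (q + 1)
    simp only [Nat.add_sub_cancel] at this
    have h' : ∑ a ∈ Finset.range (q + 1), (s + t) ^ (q - a) * s ^ a =
        ∑ a ∈ Finset.range (q + 1), s ^ a * (s + t) ^ (q - a) :=
      Finset.sum_congr rfl fun _ _ => mul_comm _ _
    rw [h']
    linear_combination -this
  refine mul_left_cancel₀ (mul_ne_zero hs ht) ?_
  rw [← h, Finset.mul_sum, Finset.mul_sum, Finset.mul_sum, ← Finset.sum_add_distrib]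
  refine Finset.sum_congr rfl fun k hk => ?_
  have hk' : N + 1 - k = N - k + 1 := by
    have := Finset.mem_range.1 hk
    omega
  rw [hk', ← mul_sub, ← mul_sub, ← hgeom s t, add_comm s t, ← hgeom t s, add_comm t s]
  simp only [Finset.mul_sum, Finset.sum_mul]
  rw [← Finset.sum_add_distrib]
  refine Finset.sum_congr rfl fun a _ => ?_
  ring

end Bernoulli

/-! ### Even points with coefficients in a supercommutative algebra -/

open scoped TensorProduct

/-- A superalgebra whose homogeneous elements commute up to the Koszul sign. -/
class Supercommutative {K Λ : Type*} [Field K] [Ring Λ] [Algebra K Λ]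
    (ℒ : ZMod 2 → Submodule K Λ) : Prop extends SetLike.GradedMonoid ℒ where
  comm : ∀ {i j : ZMod 2} {a b : Λ}, a ∈ ℒ i → b ∈ ℒ j → a * b = sgn K i j • (b * a)

section ScalarExt

variable {K : Type*} [Field K] (Λ : Type*) [Ring Λ] [Algebra K Λ]
variable {P Q R : Type*} [AddCommGroup P] [Module K P] [AddCommGroup Q] [Module K Q]
  [AddCommGroup R] [Module K R]

/-- The bilinear map `(a ⊗ p, b ⊗ q) ↦ a b ⊗ B(p, q)`. -/
noncomputable def scalarExt (B : P →ₗ[K] Q →ₗ[K] R) : Λ ⊗[K] P →ₗ[K] Λ ⊗[K] Q →ₗ[K] Λ ⊗[K] R :=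
  TensorProduct.map₂ (LinearMap.mul K Λ) B

@[simp] theorem scalarExt_tmul (B : P →ₗ[K] Q →ₗ[K] R) (a b : Λ) (p : P) (q : Q) :
    scalarExt Λ B (a ⊗ₜ p) (b ⊗ₜ q) = (a * b) ⊗ₜ B p q := by
  simp [scalarExt]

end ScalarExt

section EvenPoints

variable {K Λ : Type*} [Field K] [Ring Λ] [Algebra K Λ] (ℒ : ZMod 2 → Submodule K Λ)
variable {V : Type*} [AddCommGroup V] [Module K V] (𝒱 : ZMod 2 → Submodule K V)

/-- The even part of `Λ ⊗ V`. -/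
def evenPoints : Submodule K (Λ ⊗[K] V) :=
  Submodule.span K {z | ∃ (i : ZMod 2) (e : Λ) (v : V), e ∈ ℒ i ∧ v ∈ 𝒱 i ∧ z = e ⊗ₜ v}

variable {ℒ 𝒱}

theorem tmul_mem_evenPoints {i : ZMod 2} {e : Λ} {v : V} (he : e ∈ ℒ i) (hv : v ∈ 𝒱 i) :
    e ⊗ₜ[K] v ∈ evenPoints ℒ 𝒱 :=
  Submodule.subset_span ⟨i, e, v, he, hv, rfl⟩

/-- The inclusion of `Λ ⊗ V` in `Λ ⊗ S(V)`. -/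
noncomputable def incl (Λ : Type*) [Ring Λ] [Algebra K Λ] (𝒱 : ZMod 2 → Submodule K V) :
    Λ ⊗[K] V →ₗ[K] Λ ⊗[K] SSym 𝒱 := (SSym.ι 𝒱).lTensor Λ

@[simp] theorem incl_tmul (e : Λ) (v : V) : incl Λ 𝒱 (e ⊗ₜ v) = e ⊗ₜ[K] SSym.ι 𝒱 v := rfl

/-- The sign from exchanging the coefficients equals the sign from exchanging the vectors, and the
two cancel. -/
theorem incl_commute [Supercommutative ℒ] {z w : Λ ⊗[K] V} (hz : z ∈ evenPoints ℒ 𝒱)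
    (hw : w ∈ evenPoints ℒ 𝒱) : Commute (incl Λ 𝒱 z) (incl Λ 𝒱 w) := by
  induction hz using Submodule.span_induction with
  | mem z hz =>
    obtain ⟨i, e, v, he, hv, rfl⟩ := hz
    induction hw using Submodule.span_induction with
    | mem w hw =>
      obtain ⟨j, f, u, hf, hu, rfl⟩ := hw
      simp only [Commute, SemiconjBy, incl_tmul, Algebra.TensorProduct.tmul_mul_tmul]
      rw [Supercommutative.comm he hf, SSym.ι_comm 𝒱 hv hu, TensorProduct.smul_tmul_smul,
        sgn_mul_self, one_smul]
    | zero => simp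
    | add x y _ _ hx hy => rw [map_add]; exact hx.add_right hy
    | smul c x _ hx => rw [map_smul]; exact hx.smul_right c
  | zero => simp
  | add x y _ _ hx hy => rw [map_add]; exact hx.add_left hy
  | smul c x _ hx => rw [map_smul]; exact hx.smul_left c

variable {X : Type*} (b : Module.Basis X K V) {p : X → ZMod 2}

/-- The coordinate functionals of a homogeneous basis are homogeneous; this is what the super
Leibniz rule `pderiv_ι_mul` asks for. -/
theorem coord_eq_zero_of_mem [DirectSum.Decomposition 𝒱] (hb : ∀ i, b i ∈ 𝒱 (p i)) {j : ZMod 2} {v : V} (hv : v ∈ 𝒱 j)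
    {i : X} (hi : p i ≠ j) : b.coord i v = 0 := by
  classical
  rw [← homPart_same 𝒱 hv]
  have h : b.coord i ∘ₗ homPart 𝒱 j = 0 := by
    refine b.ext fun k => ?_
    by_cases hk : p k = j
    · rw [LinearMap.comp_apply, homPart_same 𝒱 (hk ▸ hb k)]
      have : k ≠ i := by rintro rfl; exact hi hk
      simp [this]
    · rw [LinearMap.comp_apply, homPart_ne 𝒱 (hb k) hk]
      simp
  exact LinearMap.congr_fun h v

theorem pderiv_coord_ι_mul [DirectSum.Decomposition 𝒱] (hb : ∀ i, b i ∈ 𝒱 (p i)) (i : X) {j : ZMod 2} {v : V} (hv : v ∈ 𝒱 j)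
    (a : SSym 𝒱) : pderiv 𝒱 (b.coord i) (SSym.ι 𝒱 v * a) =
      b.coord i v • a + sgn K (p i) j • (SSym.ι 𝒱 v * pderiv 𝒱 (b.coord i) a) := by
  refine pderiv_ι_mul 𝒱 _ (fun x hx => coord_eq_zero_of_mem b hb hx ?_) hv a
  intro h
  exact absurd (left_eq_add.1 h) (by decide)

variable [Fintype X]

/-- A derivation extended by `lTensor` ignores the parity of coefficients, so carrying it past z
twists the coefficients of z by signs. Moving a coefficient of the same parity as the derivation to
the left undoes the twist; in this way ∂^i z^n obeys the ordinary power rule. -/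
theorem incl_twist_mul [Supercommutative ℒ] (ζ : X → Λ) (hζ : ∀ i, ζ i ∈ ℒ (p i)) {j : ZMod 2} {e : Λ}
    (he : e ∈ ℒ j) (y : Λ ⊗[K] SSym 𝒱) :
    incl Λ 𝒱 (∑ k, (sgn K j (p k) • ζ k) ⊗ₜ b k) * ((e ⊗ₜ 1) * y) =
      (e ⊗ₜ 1) * (incl Λ 𝒱 (∑ k, ζ k ⊗ₜ b k) * y) := by
  rw [← mul_assoc, ← mul_assoc]
  congr 1
  simp only [map_sum, Finset.sum_mul, Finset.mul_sum, incl_tmul,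
    Algebra.TensorProduct.tmul_mul_tmul, mul_one, one_mul]
  refine Finset.sum_congr rfl fun k _ => ?_
  rw [Supercommutative.comm he (hζ k), smul_mul_assoc]

variable [DirectSum.Decomposition 𝒱]

theorem exists_eq_sum_of_mem_evenPoints (hb : ∀ i, b i ∈ 𝒱 (p i)) {z : Λ ⊗[K] V}
    (hz : z ∈ evenPoints ℒ 𝒱) :
    ∃ ζ : X → Λ, (∀ i, ζ i ∈ ℒ (p i)) ∧ z = ∑ i, ζ i ⊗ₜ[K] b i := by
  induction hz using Submodule.span_induction with
  | mem z hz =>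
    obtain ⟨j, e, v, he, hv, rfl⟩ := hz
    refine ⟨fun i => b.coord i v • e, fun i => ?_, ?_⟩
    · by_cases hi : p i = j
      · exact Submodule.smul_mem _ _ (hi ▸ he)
      · dsimp only
        rw [coord_eq_zero_of_mem b hb hv hi, zero_smul]
        exact zero_mem _
    · conv_lhs => rw [← b.sum_repr v, TensorProduct.tmul_sum]
      refine Finset.sum_congr rfl fun i _ => ?_
      rw [TensorProduct.tmul_smul, TensorProduct.smul_tmul']
      rfl
  | zero => exact ⟨0, fun i => zero_mem _, by simp⟩
  | add x y _ _ hx hy =>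
    obtain ⟨ζ, h1, rfl⟩ := hx
    obtain ⟨η, h2, rfl⟩ := hy
    exact ⟨ζ + η, fun i => add_mem (h1 i) (h2 i), by
      simp [TensorProduct.add_tmul, Finset.sum_add_distrib]⟩
  | smul c x _ hx =>
    obtain ⟨ζ, h1, rfl⟩ := hx
    exact ⟨c • ζ, fun i => Submodule.smul_mem _ c (h1 i), by
      simp [TensorProduct.smul_tmul', Finset.smul_sum]⟩

variable (ζ : X → Λ)

theorem lTensor_pderiv_incl_mul (hb : ∀ i, b i ∈ 𝒱 (p i)) (i : X) (y : Λ ⊗[K] SSym 𝒱) :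
    (pderiv 𝒱 (b.coord i)).lTensor Λ (incl Λ 𝒱 (∑ k, ζ k ⊗ₜ b k) * y) =
      (ζ i ⊗ₜ 1) * y + incl Λ 𝒱 (∑ k, (sgn K (p i) (p k) • ζ k) ⊗ₜ b k) *
        (pderiv 𝒱 (b.coord i)).lTensor Λ y := by
  classical
  induction y using TensorProduct.induction_on with
  | zero => simp
  | add y y' hy hy' => simp only [mul_add, map_add, hy, hy']; abel
  | tmul f a =>
    simp only [map_sum, Finset.sum_mul, incl_tmul, LinearMap.lTensor_tmul,
      Algebra.TensorProduct.tmul_mul_tmul, pderiv_coord_ι_mul b hb i (hb _),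
      TensorProduct.tmul_add, Finset.sum_add_distrib, one_mul]
    congr 1
    · rw [Finset.sum_eq_single i]
      · simp
      · intro k _ hk
        simp [hk]
      · simp
    · refine Finset.sum_congr rfl fun k _ => ?_
      rw [TensorProduct.tmul_smul, TensorProduct.smul_tmul', smul_mul_assoc]

theorem lTensor_pderiv_pow [Supercommutative ℒ] (hb : ∀ i, b i ∈ 𝒱 (p i))
    (hζ : ∀ i, ζ i ∈ ℒ (p i)) (i : X) (n : ℕ) :
    (pderiv 𝒱 (b.coord i)).lTensor Λ (incl Λ 𝒱 (∑ k, ζ k ⊗ₜ b k) ^ n) =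
      n • ((ζ i ⊗ₜ 1) * incl Λ 𝒱 (∑ k, ζ k ⊗ₜ b k) ^ (n - 1)) := by
  induction n with
  | zero => simp [Algebra.TensorProduct.one_def, pderiv_one]
  | succ n ih =>
    rw [pow_succ', lTensor_pderiv_incl_mul b ζ hb, ih, mul_smul_comm,
      incl_twist_mul b ζ hζ (hζ i)]
    cases n with
    | zero => simp
    | succ n =>
      rw [Nat.add_sub_cancel, Nat.add_sub_cancel, ← pow_succ', add_comm, ← succ_nsmul]

end EvenPoints

open scoped TensorProduct

theorem sgn_add_right {K : Type*} [Field K] (i j k : ZMod 2) :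
    sgn K i (j + k) = sgn K i j * sgn K i k := by
  have h11 : (1 + 1 : ZMod 2) = 0 := rfl
  rcases zmod_two_eq i with rfl | rfl <;> rcases zmod_two_eq j with rfl | rfl <;>
    rcases zmod_two_eq k with rfl | rfl <;>
      simp [sgn_zero_left, sgn_zero_right, sgn_one_one, h11]

/-! ### Power series in locally nilpotent operators -/

section LocallyNilpotent

variable {K M : Type*} [Field K] [AddCommGroup M] [Module K M]

theorem finsum_pow_smul_eq_sum (c : ℕ → K) (D : Module.End K M) {m : M} {n : ℕ}
    (hn : ∀ r, n ≤ r → (D ^ r) m = 0) :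
    ∑ᶠ r, c r • (D ^ r) m = ∑ r ∈ Finset.range n, c r • (D ^ r) m := by
  refine finsum_eq_sum_of_support_subset _ fun r hr => ?_
  by_contra h
  simp only [Finset.coe_range, Set.mem_Iio, not_lt] at h
  exact hr (by simp only [hn r h, smul_zero])

/-- The power series `∑ c_r D^r` in a locally nilpotent endomorphism `D`. -/
noncomputable def seriesEnd (c : ℕ → K) (D : Module.End K M)
    (hD : ∀ m, ∃ n, ∀ r, n ≤ r → (D ^ r) m = 0) : Module.End K M where
  toFun m := ∑ᶠ r, c r • (D ^ r) m
  map_add' m m' := by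
    obtain ⟨n, hn⟩ := hD m
    obtain ⟨n', hn'⟩ := hD m'
    have h1 : ∀ r, max n n' ≤ r → (D ^ r) m = 0 := fun r hr => hn r (le_trans (by simp) hr)
    have h2 : ∀ r, max n n' ≤ r → (D ^ r) m' = 0 := fun r hr => hn' r (le_trans (by simp) hr)
    rw [finsum_pow_smul_eq_sum c D h1, finsum_pow_smul_eq_sum c D h2,
      finsum_pow_smul_eq_sum c D (n := max n n') (fun r hr => by rw [map_add, h1 r hr, h2 r hr,
        add_zero]), ← Finset.sum_add_distrib]
    simp
  map_smul' a m := by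
    obtain ⟨n, hn⟩ := hD m
    rw [finsum_pow_smul_eq_sum c D hn,
      finsum_pow_smul_eq_sum c D (n := n) (fun r hr => by rw [map_smul, hn r hr, smul_zero]),
      Finset.smul_sum]
    refine Finset.sum_congr rfl fun r _ => ?_
    rw [map_smul, smul_comm]
    rfl

theorem seriesEnd_apply (c : ℕ → K) (D : Module.End K M)
    (hD : ∀ m, ∃ n, ∀ r, n ≤ r → (D ^ r) m = 0) {m : M} {n : ℕ}
    (hn : ∀ r, n ≤ r → (D ^ r) m = 0) :
    seriesEnd c D hD m = ∑ r ∈ Finset.range n, c r • (D ^ r) m :=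
  finsum_pow_smul_eq_sum c D hn

theorem lTensor_seriesEnd {Λ : Type*} [Ring Λ] [Algebra K Λ] (c : ℕ → K) (D : Module.End K M)
    (hD : ∀ m, ∃ n, ∀ r, n ≤ r → (D ^ r) m = 0) {t : Λ ⊗[K] M} {n : ℕ}
    (hn : ∀ r, n ≤ r → (D.lTensor Λ ^ r) t = 0) :
    (seriesEnd c D hD).lTensor Λ t = ∑ r ∈ Finset.range n, c r • (D.lTensor Λ ^ r) t := by
  -- The bound `n` valid for `t` need not hold for the pure tensors that make up `t`. So the formula
  -- is proved for all large cut-offs and shortened to `n` at the end.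
  have key : ∃ N, ∀ N', N ≤ N' → (seriesEnd c D hD).lTensor Λ t =
      ∑ r ∈ Finset.range N', c r • (D.lTensor Λ ^ r) t := by
    clear hn
    induction t using TensorProduct.induction_on with
    | zero => exact ⟨0, by simp⟩
    | add x y hx hy =>
      obtain ⟨N, hN⟩ := hx
      obtain ⟨N', hN'⟩ := hy
      refine ⟨max N N', fun R hR => ?_⟩
      rw [map_add, hN R (le_trans (by simp) hR), hN' R (le_trans (by simp) hR),
        ← Finset.sum_add_distrib]
      simp
    | tmul a m =>
      obtain ⟨N, hN⟩ := hD m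
      refine ⟨N, fun N' hN' => ?_⟩
      rw [LinearMap.lTensor_tmul, seriesEnd_apply c D hD fun r hr => hN r (hN'.trans hr),
        TensorProduct.tmul_sum]
      refine Finset.sum_congr rfl fun r _ => ?_
      rw [TensorProduct.tmul_smul, LinearMap.lTensor_pow, LinearMap.lTensor_tmul]
  obtain ⟨N, hN⟩ := key
  rw [hN (max N n) (le_max_left _ _)]
  symm
  refine Finset.sum_subset (by simp) fun r _ hr => ?_
  rw [hn r (by simpa using hr), smul_zero]

end LocallyNilpotent

/-! ### The degree filtration of S(V) -/

section Filtration

variable {K V : Type*} [Field K] [AddCommGroup V] [Module K V] (𝒱 : ZMod 2 → Submodule K V)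

/-- The span of the products of less than `n` vectors. -/
def symFiltration (n : ℕ) : Submodule K (SSym 𝒱) :=
  Submodule.span K {u | ∃ l : List V, l.length < n ∧ u = (l.map (SSym.ι 𝒱)).prod}

/-- Counting strictly fewer than `n` factors makes the lowest step zero, so `n` derivations
annihilate step `n`. -/
theorem symFiltration_zero : symFiltration 𝒱 0 = ⊥ := by
  simp [symFiltration]

theorem symFiltration_mono {n m : ℕ} (h : n ≤ m) : symFiltration 𝒱 n ≤ symFiltration 𝒱 m := by
  refine Submodule.span_mono ?_
  rintro u ⟨l, hl, rfl⟩
  exact ⟨l, hl.trans_le h, rfl⟩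

theorem ι_mul_mem_symFiltration (x : V) {n : ℕ} {u : SSym 𝒱} (hu : u ∈ symFiltration 𝒱 n) :
    SSym.ι 𝒱 x * u ∈ symFiltration 𝒱 (n + 1) := by
  induction hu using Submodule.span_induction with
  | mem u hu =>
    obtain ⟨l, hl, rfl⟩ := hu
    exact Submodule.subset_span ⟨x :: l, by simpa using hl, by simp⟩
  | zero => simp
  | add u v _ _ hu hv => rw [mul_add]; exact add_mem hu hv
  | smul c u _ hu => rw [mul_smul_comm]; exact Submodule.smul_mem _ c hu

theorem exists_mem_symFiltration (u : SSym 𝒱) : ∃ n, u ∈ symFiltration 𝒱 n := by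
  induction u using SSym.induction 𝒱 with
  | one => exact ⟨1, Submodule.subset_span ⟨[], by simp, by simp⟩⟩
  | ι_mul x a ha =>
    obtain ⟨n, hn⟩ := ha
    exact ⟨n + 1, ι_mul_mem_symFiltration 𝒱 x hn⟩
  | add a b ha hb =>
    obtain ⟨n, hn⟩ := ha
    obtain ⟨m, hm⟩ := hb
    exact ⟨max n m, add_mem (symFiltration_mono 𝒱 (le_max_left _ _) hn)
      (symFiltration_mono 𝒱 (le_max_right _ _) hm)⟩
  | smul c a ha =>
    obtain ⟨n, hn⟩ := ha
    exact ⟨n, Submodule.smul_mem _ c hn⟩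

variable {𝒱} [DirectSum.Decomposition 𝒱] {X : Type*} (b : Module.Basis X K V) {p : X → ZMod 2}

theorem pderiv_mem_symFiltration (hb : ∀ i, b i ∈ 𝒱 (p i)) (i : X) {n : ℕ} {u : SSym 𝒱}
    (hu : u ∈ symFiltration 𝒱 (n + 1)) : pderiv 𝒱 (b.coord i) u ∈ symFiltration 𝒱 n := by
  induction hu using Submodule.span_induction with
  | mem u hu =>
    obtain ⟨l, hl, rfl⟩ := hu
    induction l generalizing n with
    | nil => simp [pderiv_one]
    | cons x l ih =>
      simp only [List.length_cons, add_lt_add_iff_right] at hl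
      have h1 : pderiv 𝒱 (b.coord i) (((x :: l).map (SSym.ι 𝒱)).prod) =
          b.coord i x • (l.map (SSym.ι 𝒱)).prod +
          SSym.ι 𝒱 (sgn K (p i) 0 • homPart 𝒱 0 x + sgn K (p i) 1 • homPart 𝒱 1 x) *
            pderiv 𝒱 (b.coord i) (l.map (SSym.ι 𝒱)).prod := by
        conv_lhs => rw [List.map_cons, List.prod_cons, ← homPart_add 𝒱 x, map_add, add_mul,
          map_add, pderiv_coord_ι_mul b hb i (homPart_mem 𝒱 0 x),
          pderiv_coord_ι_mul b hb i (homPart_mem 𝒱 1 x)]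
        conv_rhs => rw [map_add, map_smul, map_smul, add_mul, smul_mul_assoc, smul_mul_assoc]
        nth_rw 5 [← homPart_add 𝒱 x]
        rw [map_add, add_smul]
        abel
      rw [h1]
      refine add_mem (Submodule.smul_mem _ _ (Submodule.subset_span ⟨l, hl, rfl⟩)) ?_
      obtain ⟨n, rfl⟩ := Nat.exists_eq_succ_of_ne_zero (by omega : n ≠ 0)
      exact ι_mul_mem_symFiltration 𝒱 _ (ih hl)
  | zero => simp
  | add u v _ _ hu hv => rw [map_add]; exact add_mem hu hv
  | smul c u _ hu => rw [map_smul]; exact Submodule.smul_mem _ c hu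

end Filtration

/-! ### The bracket on even points -/

section Bracket

variable {K g : Type*} [Field K] [AddCommGroup g] [Module K g]
variable {𝔤 : ZMod 2 → Submodule K g} (L : LieSuperalgebra 𝔤)

/-- The Jacobi identity in the form suited to ad~: bracketing with z from the right is a derivation
up to sign. -/
theorem LieSuperalgebra.bracket_bracket {i j k : ZMod 2} {x y z : g} (hx : x ∈ 𝔤 i)
    (hy : y ∈ 𝔤 j) (hz : z ∈ 𝔤 k) : L.bracket (L.bracket x y) z =
      sgn K j k • L.bracket (L.bracket x z) y + L.bracket x (L.bracket y z) := by
  rw [L.jacobi hx hy hz, L.bracket_skew hy (L.bracket_mem hx hz), sgn_add_right, sgn_comm j i,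
    smul_neg, smul_smul, ← mul_assoc, sgn_mul_self, one_mul]
  abel

variable {Λ : Type*} [Ring Λ] [Algebra K Λ] {ℒ : ZMod 2 → Submodule K Λ}

/-- The operator `w ↦ [w, z]` on `Λ ⊗ g`. -/
noncomputable def adExt (z : Λ ⊗[K] g) : Module.End K (Λ ⊗[K] g) :=
  (scalarExt Λ L.bracket).flip z

theorem adExt_apply (z w : Λ ⊗[K] g) : adExt L z w = scalarExt Λ L.bracket w z := rfl

variable [Supercommutative ℒ]

theorem scalarExt_bracket_mem {w z : Λ ⊗[K] g} (hw : w ∈ evenPoints ℒ 𝔤)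
    (hz : z ∈ evenPoints ℒ 𝔤) : scalarExt Λ L.bracket w z ∈ evenPoints ℒ 𝔤 := by
  induction hz using Submodule.span_induction with
  | mem z hz =>
    obtain ⟨i, e, v, he, hv, rfl⟩ := hz
    induction hw using Submodule.span_induction with
    | mem w hw =>
      obtain ⟨j, f, u, hf, hu, rfl⟩ := hw
      rw [scalarExt_tmul]
      exact tmul_mem_evenPoints (SetLike.GradedMonoid.toGradedMul.mul_mem hf he)
        (L.bracket_mem hu hv)
    | zero => simp
    | add x y _ _ hx hy => rw [map_add, LinearMap.add_apply]; exact add_mem hx hy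
    | smul c x _ hx =>
      rw [map_smul, LinearMap.smul_apply]; exact Submodule.smul_mem _ c hx
  | zero => simp
  | add x y _ _ hx hy => rw [map_add]; exact add_mem hx hy
  | smul c x _ hx => rw [map_smul]; exact Submodule.smul_mem _ c hx

theorem scalarExt_bracket_skew {w z : Λ ⊗[K] g} (hw : w ∈ evenPoints ℒ 𝔤)
    (hz : z ∈ evenPoints ℒ 𝔤) : scalarExt Λ L.bracket w z = -scalarExt Λ L.bracket z w := by
  induction hz using Submodule.span_induction with
  | mem z hz =>
    obtain ⟨i, e, v, he, hv, rfl⟩ := hz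
    induction hw using Submodule.span_induction with
    | mem w hw =>
      obtain ⟨j, f, u, hf, hu, rfl⟩ := hw
      rw [scalarExt_tmul, scalarExt_tmul, Supercommutative.comm hf he, L.bracket_skew hu hv,
        TensorProduct.tmul_neg, TensorProduct.smul_tmul_smul, sgn_mul_self, one_smul]
    | zero => simp
    | add x y _ _ hx hy => rw [map_add, LinearMap.add_apply, map_add, hx, hy, neg_add]
    | smul c x _ hx => rw [map_smul, LinearMap.smul_apply, map_smul, hx, smul_neg]
  | zero => simp
  | add x y _ _ hx hy => rw [map_add, map_add, LinearMap.add_apply, hx, hy, neg_add]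
  | smul c x _ hx => rw [map_smul, map_smul, LinearMap.smul_apply, hx, smul_neg]

/-- The sign in the Jacobi identity is absorbed by commuting the coefficients of w and z, so ad_z is
an honest derivation. This is what later identifies s + t with ad_z. -/
theorem adExt_scalarExt_bracket {u w z : Λ ⊗[K] g} (hu : u ∈ evenPoints ℒ 𝔤)
    (hw : w ∈ evenPoints ℒ 𝔤) (hz : z ∈ evenPoints ℒ 𝔤) :
    adExt L z (scalarExt Λ L.bracket u w) =
      scalarExt Λ L.bracket (adExt L z u) w + scalarExt Λ L.bracket u (adExt L z w) := by
  simp only [adExt_apply]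
  induction hu using Submodule.span_induction with
  | mem u hu =>
    obtain ⟨i, e, x, he, hx, rfl⟩ := hu
    induction hw using Submodule.span_induction with
    | mem w hw =>
      obtain ⟨j, f, y, hf, hy, rfl⟩ := hw
      induction hz using Submodule.span_induction with
      | mem z hz =>
        obtain ⟨k, ζ, z, hζ, hz, rfl⟩ := hz
        simp only [scalarExt_tmul]
        rw [L.bracket_bracket hx hy hz, TensorProduct.tmul_add, mul_assoc, mul_assoc]
        congr 1
        rw [Supercommutative.comm hf hζ, mul_smul_comm, TensorProduct.smul_tmul_smul,
          sgn_mul_self, one_smul]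
      | zero => simp
      | add a b _ _ ha hb => simp only [map_add, LinearMap.add_apply, ha, hb]; abel
      | smul c a _ ha => simp only [map_smul, LinearMap.smul_apply, ha, smul_add]
    | zero => simp
    | add a b _ _ ha hb => simp only [map_add, LinearMap.add_apply, ha, hb]; abel
    | smul c a _ ha => simp only [map_smul, LinearMap.smul_apply, ha, smul_add]
  | zero => simp
  | add a b _ _ ha hb => simp only [map_add, LinearMap.add_apply, ha, hb]; abel
  | smul c a _ ha => simp only [map_smul, LinearMap.smul_apply, ha, smul_add]

theorem adExt_pow_mem {w z : Λ ⊗[K] g} (hw : w ∈ evenPoints ℒ 𝔤) (hz : z ∈ evenPoints ℒ 𝔤)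
    (r : ℕ) : (adExt L z ^ r) w ∈ evenPoints ℒ 𝔤 := by
  induction r with
  | zero => simpa
  | succ r ih => rw [pow_succ', Module.End.mul_apply]; exact scalarExt_bracket_mem L ih hz

end Bracket

open scoped TensorProduct

/-! ### The operator D and its powers on even points -/

section Polarised

variable {K g : Type*} [Field K] [AddCommGroup g] [Module K g]
variable {𝔤 : ZMod 2 → Submodule K g} (L : LieSuperalgebra 𝔤)
variable {X : Type*} [Fintype X] (b : Module.Basis X K g) {p : X → ZMod 2}
variable (Λ : Type*) [Ring Λ] [Algebra K Λ]

/-- The multiplication `x ⊗ y ↦ x y`. -/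
noncomputable def mulMap (𝔤 : ZMod 2 → Submodule K g) : g ⊗[K] SSym 𝔤 →ₗ[K] SSym 𝔤 :=
  TensorProduct.lift (LinearMap.mul K (SSym 𝔤) ∘ₗ SSym.ι 𝔤)

@[simp] theorem mulMap_tmul (x : g) (y : SSym 𝔤) : mulMap 𝔤 (x ⊗ₜ y) = SSym.ι 𝔤 x * y := rfl

/-- The map `(a ⊗ x, b ⊗ y) ↦ a b ⊗ (x ⊗ y)`. -/
noncomputable abbrev boxExt (𝔤 : ZMod 2 → Submodule K g) :
    Λ ⊗[K] g →ₗ[K] Λ ⊗[K] SSym 𝔤 →ₗ[K] Λ ⊗[K] (g ⊗[K] SSym 𝔤) :=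
  scalarExt Λ (TensorProduct.mk K g (SSym 𝔤))

variable {Λ}

theorem lTensor_mulMap_boxExt (w : Λ ⊗[K] g) (y : Λ ⊗[K] SSym 𝔤) :
    (mulMap 𝔤).lTensor Λ (boxExt Λ 𝔤 w y) = incl Λ 𝔤 w * y := by
  induction w using TensorProduct.induction_on with
  | zero => simp
  | add a b ha hb => rw [map_add, LinearMap.add_apply, map_add, map_add, add_mul, ha, hb]
  | tmul e x =>
    induction y using TensorProduct.induction_on with
    | zero => simp
    | add a b ha hb => rw [map_add, map_add, mul_add, ha, hb]
    | tmul f y => simp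

/-- The derivatives ∂^i leave the coefficients ζ_i of z to the left of y. Absorbed into w from the
right, with no sign, they assemble the operators ad~_{X_i} into ad_z. -/
theorem sum_boxExt_adTilde (w : Λ ⊗[K] g) (ζ : X → Λ) (y : Λ ⊗[K] SSym 𝔤) :
    ∑ i, boxExt Λ 𝔤 ((L.adTilde (b i)).lTensor Λ w) ((ζ i ⊗ₜ 1) * y) =
      boxExt Λ 𝔤 (adExt L (∑ k, ζ k ⊗ₜ b k) w) y := by
  induction w using TensorProduct.induction_on with
  | zero => simp
  | add a b ha hb => simp only [map_add, LinearMap.add_apply, ha, hb, Finset.sum_add_distrib]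
  | tmul e x =>
    induction y using TensorProduct.induction_on with
    | zero => simp
    | add a b ha hb => simp only [mul_add, map_add, ha, hb, Finset.sum_add_distrib]
    | tmul f y => simp [adExt_apply, LieSuperalgebra.adTilde, mul_assoc]

variable [DirectSum.Decomposition 𝔤]

/-- The operator `x ⊗ y ↦ ∑ [x, X_i] ⊗ ∂^i y` on `g ⊗ S(g)`. -/
noncomputable def adDeriv : Module.End K (g ⊗[K] SSym 𝔤) :=
  ∑ i, TensorProduct.map (L.adTilde (b i)) (pderiv 𝔤 (b.coord i))

/-- Each application of D differentiates the second factor once and so lowers its degree. -/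
theorem adDeriv_pow_tmul (hb : ∀ i, b i ∈ 𝔤 (p i)) {n : ℕ} {y : SSym 𝔤}
    (hy : y ∈ symFiltration 𝔤 n) (x : g) {r : ℕ} (hr : n ≤ r) :
    (adDeriv L b ^ r) (x ⊗ₜ y) = 0 := by
  induction n generalizing x y r with
  | zero =>
    rw [symFiltration_zero, Submodule.mem_bot] at hy
    simp [hy]
  | succ n ih =>
    obtain ⟨r, rfl⟩ := Nat.exists_eq_succ_of_ne_zero (by omega : r ≠ 0)
    rw [Nat.succ_eq_add_one, pow_succ, Module.End.mul_apply, adDeriv, LinearMap.sum_apply,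
      map_sum]
    refine Finset.sum_eq_zero fun i _ => ?_
    rw [TensorProduct.map_tmul]
    exact ih (pderiv_mem_symFiltration b hb i hy) _ (by omega)

theorem adDeriv_locallyNilpotent (hb : ∀ i, b i ∈ 𝔤 (p i)) (t : g ⊗[K] SSym 𝔤) :
    ∃ n, ∀ r, n ≤ r → (adDeriv L b ^ r) t = 0 := by
  induction t using TensorProduct.induction_on with
  | zero => exact ⟨0, by simp⟩
  | add x y hx hy =>
    obtain ⟨n, hn⟩ := hx
    obtain ⟨m, hm⟩ := hy
    exact ⟨max n m, fun r hr => by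
      rw [map_add, hn r (le_trans (by simp) hr), hm r (le_trans (by simp) hr), add_zero]⟩
  | tmul x y =>
    obtain ⟨n, hn⟩ := exists_mem_symFiltration 𝔤 y
    exact ⟨n, fun r hr => adDeriv_pow_tmul L b hb hn x hr⟩

/-- The operators `y ↦ ∑ c_r μ(D^r(x ⊗ y))` on `S(g)`, with `D` the operator `adDeriv` and `μ` the
multiplication. -/
noncomputable def seriesAction (hb : ∀ i, b i ∈ 𝔤 (p i)) (c : ℕ → K) :
    g →ₗ[K] SSym 𝔤 →ₗ[K] SSym 𝔤 :=
  LinearMap.compr₂ (TensorProduct.mk K g (SSym 𝔤))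
    (mulMap 𝔤 ∘ₗ seriesEnd c (adDeriv L b) (adDeriv_locallyNilpotent L b hb))

theorem scalarExt_seriesAction (hb : ∀ i, b i ∈ 𝔤 (p i)) (c : ℕ → K) (w : Λ ⊗[K] g)
    (y : Λ ⊗[K] SSym 𝔤) : scalarExt Λ (seriesAction L b hb c) w y =
      (mulMap 𝔤).lTensor Λ ((seriesEnd c (adDeriv L b)
        (adDeriv_locallyNilpotent L b hb)).lTensor Λ (boxExt Λ 𝔤 w y)) := by
  induction w using TensorProduct.induction_on with
  | zero => simp
  | add a b ha hb => simp only [map_add, LinearMap.add_apply, ha, hb]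
  | tmul e x =>
    induction y using TensorProduct.induction_on with
    | zero => simp
    | add a b ha hb => simp only [map_add, ha, hb]
    | tmul f y => simp [seriesAction]

theorem lTensor_adDeriv_boxExt (w : Λ ⊗[K] g) (y : Λ ⊗[K] SSym 𝔤) :
    (adDeriv L b).lTensor Λ (boxExt Λ 𝔤 w y) =
      ∑ i, boxExt Λ 𝔤 ((L.adTilde (b i)).lTensor Λ w)
        ((pderiv 𝔤 (b.coord i)).lTensor Λ y) := by
  induction w using TensorProduct.induction_on with
  | zero => simp
  | add a b ha hb => simp only [map_add, LinearMap.add_apply, ha, hb, Finset.sum_add_distrib]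
  | tmul e x =>
    induction y using TensorProduct.induction_on with
    | zero => simp
    | add a b ha hb => simp only [map_add, ha, hb, Finset.sum_add_distrib]
    | tmul f y => simp [adDeriv, TensorProduct.tmul_sum]

variable {ℒ : ZMod 2 → Submodule K Λ} [Supercommutative ℒ]

theorem lTensor_adDeriv_pow (hb : ∀ i, b i ∈ 𝔤 (p i)) {z : Λ ⊗[K] g}
    (hz : z ∈ evenPoints ℒ 𝔤) (w : Λ ⊗[K] g) (n : ℕ) :
    (adDeriv L b).lTensor Λ (boxExt Λ 𝔤 w (incl Λ 𝔤 z ^ n)) =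
      n • boxExt Λ 𝔤 (adExt L z w) (incl Λ 𝔤 z ^ (n - 1)) := by
  obtain ⟨ζ, hζ, rfl⟩ := exists_eq_sum_of_mem_evenPoints b hb hz
  rw [lTensor_adDeriv_boxExt, ← sum_boxExt_adTilde, Finset.smul_sum]
  refine Finset.sum_congr rfl fun i _ => ?_
  rw [lTensor_pderiv_pow b ζ hb hζ, map_nsmul]

theorem lTensor_adDeriv_mul_pow (hb : ∀ i, b i ∈ 𝔤 (p i)) {v z : Λ ⊗[K] g}
    (hv : v ∈ evenPoints ℒ 𝔤) (hz : z ∈ evenPoints ℒ 𝔤) (w : Λ ⊗[K] g) (n : ℕ) :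
    (adDeriv L b).lTensor Λ (boxExt Λ 𝔤 w (incl Λ 𝔤 v * incl Λ 𝔤 z ^ n)) =
      boxExt Λ 𝔤 (adExt L v w) (incl Λ 𝔤 z ^ n) +
      n • boxExt Λ 𝔤 (adExt L z w) (incl Λ 𝔤 v * incl Λ 𝔤 z ^ (n - 1)) := by
  obtain ⟨ζ, hζ, rfl⟩ := exists_eq_sum_of_mem_evenPoints b hb hz
  obtain ⟨ν, hν, rfl⟩ := exists_eq_sum_of_mem_evenPoints b hb hv
  rw [lTensor_adDeriv_boxExt, ← sum_boxExt_adTilde, ← sum_boxExt_adTilde, Finset.smul_sum,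
    ← Finset.sum_add_distrib]
  refine Finset.sum_congr rfl fun i _ => ?_
  rw [lTensor_pderiv_incl_mul b ν hb, lTensor_pderiv_pow b ζ hb hζ, mul_smul_comm,
    incl_twist_mul b ν hν (hζ i), map_add, map_nsmul]

/-- Each application of D removes one factor z from the power and brackets w with it. No parity is
imposed on w. -/
theorem lTensor_adDeriv_pow_pow (hb : ∀ i, b i ∈ 𝔤 (p i)) {z : Λ ⊗[K] g}
    (hz : z ∈ evenPoints ℒ 𝔤) (w : Λ ⊗[K] g) (n r : ℕ) :
    ((adDeriv L b).lTensor Λ ^ r) (boxExt Λ 𝔤 w (incl Λ 𝔤 z ^ n)) =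
      n.descFactorial r • boxExt Λ 𝔤 ((adExt L z ^ r) w) (incl Λ 𝔤 z ^ (n - r)) := by
  induction r with
  | zero => simp
  | succ r ih =>
    rw [pow_succ', Module.End.mul_apply, ih, map_nsmul, lTensor_adDeriv_pow L b hb hz, smul_smul,
      pow_succ', Module.End.mul_apply, Nat.descFactorial_succ, mul_comm, Nat.sub_sub]

/-- Among the r applications of D, either none or exactly one consumes v. In the second case `a`
counts the applications before it, and r − 1 factors z are consumed. For r = 0 the inner sum is
empty, so the truncated r − 1 does no harm. -/
theorem lTensor_adDeriv_pow_mul_pow (hb : ∀ i, b i ∈ 𝔤 (p i)) {v z : Λ ⊗[K] g}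
    (hv : v ∈ evenPoints ℒ 𝔤) (hz : z ∈ evenPoints ℒ 𝔤) (w : Λ ⊗[K] g) (n r : ℕ) :
    ((adDeriv L b).lTensor Λ ^ r) (boxExt Λ 𝔤 w (incl Λ 𝔤 v * incl Λ 𝔤 z ^ n)) =
      n.descFactorial r •
        boxExt Λ 𝔤 ((adExt L z ^ r) w) (incl Λ 𝔤 v * incl Λ 𝔤 z ^ (n - r)) +
      n.descFactorial (r - 1) • boxExt Λ 𝔤 (∑ a ∈ Finset.range r,
        (adExt L z ^ (r - 1 - a)) (adExt L v ((adExt L z ^ a) w)))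
          (incl Λ 𝔤 z ^ (n - (r - 1))) := by
  induction r with
  | zero => simp
  | succ r ih =>
    rw [pow_succ', Module.End.mul_apply, ih, map_add, map_nsmul, map_nsmul,
      lTensor_adDeriv_mul_pow L b hb hv hz, lTensor_adDeriv_pow L b hb hz, Nat.add_sub_cancel,
      smul_add, smul_smul, smul_smul, pow_succ', Module.End.mul_apply,
      Nat.descFactorial_succ n r, mul_comm (n - r), Nat.sub_sub n r, Finset.sum_range_succ,
      Nat.sub_self, pow_zero, Module.End.one_apply, map_add, LinearMap.add_apply, smul_add]
    rw [add_assoc, add_left_comm]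
    congr 1
    rw [add_comm]
    congr 1
    rcases r with _ | r
    · simp
    · rw [Nat.add_sub_cancel, Nat.descFactorial_succ, mul_comm (n - r), Nat.sub_sub, map_sum]
      congr 3
      refine Finset.sum_congr rfl fun a ha => ?_
      rw [← Module.End.mul_apply, ← pow_succ', show r - a + 1 = r + 1 - a by
        have := Finset.mem_range.1 ha
        omega]

end Polarised

open scoped TensorProduct

/-! ### The commutation relation on powers of even points -/

section Representation

variable {K g : Type*} [Field K] [AddCommGroup g] [Module K g]
variable {𝔤 : ZMod 2 → Submodule K g} (L : LieSuperalgebra 𝔤)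
variable {Λ : Type*} [Ring Λ] [Algebra K Λ] {ℒ : ZMod 2 → Submodule K Λ} [Supercommutative ℒ]

/-- The coefficients `B_r / r!`, for the Bernoulli numbers with `B_1 = 1/2`. -/
noncomputable def bernoulliCoeff (K : Type*) [Field K] (r : ℕ) : K :=
  (bernoulli' r : K) / (r.factorial : K)

theorem bernoulliCoeff_eq [CharZero K] (r : ℕ) :
    bernoulliCoeff K r = algebraMap ℚ K (bernoulli' r / r.factorial) := by
  simp [bernoulliCoeff]

/-- The linear map `s^i t^j ↦ [ad_z^i u, ad_z^j w]`. -/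
noncomputable def bracketEval (u w z : Λ ⊗[K] g) : MvPolynomial (Fin 2) K →ₗ[K] Λ ⊗[K] g :=
  (MvPolynomial.basisMonomials (Fin 2) K).constr K fun m =>
    scalarExt Λ L.bracket ((adExt L z ^ m 0) u) ((adExt L z ^ m 1) w)

theorem bracketEval_monomial (u w z : Λ ⊗[K] g) (i j : ℕ) :
    bracketEval L u w z (MvPolynomial.X 0 ^ i * MvPolynomial.X 1 ^ j) =
      scalarExt Λ L.bracket ((adExt L z ^ i) u) ((adExt L z ^ j) w) := by
  have h : (MvPolynomial.X 0 ^ i * MvPolynomial.X 1 ^ j : MvPolynomial (Fin 2) K) =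
      MvPolynomial.basisMonomials (Fin 2) K (Finsupp.single 0 i + Finsupp.single 1 j) := by
    rw [MvPolynomial.X_pow_eq_monomial, MvPolynomial.X_pow_eq_monomial,
      MvPolynomial.monomial_mul, one_mul, MvPolynomial.coe_basisMonomials]
  rw [h, bracketEval, Module.Basis.constr_basis]
  simp

/-- The variables s and t stand for ad_z acting on the first and second entry of the bracket. Their
sum acts as ad_z on the bracket because ad_z is a derivation. -/
theorem bracketEval_mul {u w z : Λ ⊗[K] g} (hu : u ∈ evenPoints ℒ 𝔤) (hw : w ∈ evenPoints ℒ 𝔤)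
    (hz : z ∈ evenPoints ℒ 𝔤) (f : MvPolynomial (Fin 2) K) (n : ℕ) :
    bracketEval L u w z ((MvPolynomial.X 0 + MvPolynomial.X 1) ^ n * f) =
      (adExt L z ^ n) (bracketEval L u w z f) := by
  induction n generalizing f with
  | zero => simp
  | succ n ih =>
    rw [pow_succ, mul_assoc, ih, pow_succ, Module.End.mul_apply]
    congr 1
    suffices h : bracketEval L u w z ∘ₗ LinearMap.mulLeft K (MvPolynomial.X 0 + MvPolynomial.X 1) =
        adExt L z ∘ₗ bracketEval L u w z from LinearMap.congr_fun h f
    refine (MvPolynomial.basisMonomials (Fin 2) K).ext fun m => ?_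
    have hm : MvPolynomial.basisMonomials (Fin 2) K m =
        MvPolynomial.X 0 ^ m 0 * MvPolynomial.X 1 ^ m 1 := by
      rw [MvPolynomial.coe_basisMonomials]
      dsimp only
      rw [MvPolynomial.monomial_eq,
        Finsupp.prod_fintype _ _ (by simp), Fin.prod_univ_two, map_one, one_mul]
    rw [LinearMap.comp_apply, LinearMap.comp_apply, LinearMap.mulLeft_apply, hm, add_mul,
      ← mul_assoc, ← pow_succ', mul_left_comm, ← pow_succ', map_add, bracketEval_monomial,
      bracketEval_monomial, bracketEval_monomial,
      adExt_scalarExt_bracket L (adExt_pow_mem L hu hz _) (adExt_pow_mem L hw hz _) hz,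
      pow_succ', pow_succ']
    rfl

/-- The component of degree `n` of the commutator of two of the operators `seriesAction`. -/
noncomputable def bracketSum (c : ℕ → K) (u w z : Λ ⊗[K] g) (n : ℕ) : Λ ⊗[K] g :=
  ∑ k ∈ Finset.range (n + 1), (c k * c (n - k + 1)) • ∑ a ∈ Finset.range (n - k + 1),
    (adExt L z ^ (n - k - a)) (scalarExt Λ L.bracket ((adExt L z ^ a) u) ((adExt L z ^ k) w))

/-- Skew symmetry turns the sum with u and w exchanged into the second summand of
`bernoulli_identity`, with s and t exchanged. The identity is applied to indeterminates, so that s,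
t and s + t are nonzero elements of a domain, and then evaluated by `bracketEval`. -/
theorem bracketSum_sub [CharZero K] {u w z : Λ ⊗[K] g} (hu : u ∈ evenPoints ℒ 𝔤)
    (hw : w ∈ evenPoints ℒ 𝔤) (hz : z ∈ evenPoints ℒ 𝔤) (n : ℕ) :
    bracketSum L (bernoulliCoeff K) u w z n - bracketSum L (bernoulliCoeff K) w u z n =
      bernoulliCoeff K n • (adExt L z ^ n) (scalarExt Λ L.bracket u w) := by
  have hne : (MvPolynomial.X 0 + MvPolynomial.X 1 : MvPolynomial (Fin 2) K) ≠ 0 := by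
    intro h
    have := congrArg (MvPolynomial.eval ![1, 0]) h
    simp at this
  have h := congrArg (bracketEval L u w z) (bernoulli_identity (R := MvPolynomial (Fin 2) K)
    (s := MvPolynomial.X 0) (t := MvPolynomial.X 1) (MvPolynomial.X_ne_zero 0)
    (MvPolynomial.X_ne_zero 1) hne (c := fun r => MvPolynomial.C (bernoulliCoeff K r))
    (fun r => by rw [bernoulliCoeff_eq, ← MvPolynomial.algebraMap_eq,
      ← IsScalarTower.algebraMap_apply]) n)
  have h1 := bracketEval_monomial L u w z 0 0
  simp only [pow_zero, mul_one, Module.End.one_apply] at h1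
  have h2 := bracketEval_mul L hu hw hz 1 n
  rw [h1, mul_one] at h2
  rw [← MvPolynomial.smul_eq_C_mul, map_smul, h2] at h
  rw [← h, map_sum, bracketSum, bracketSum, ← Finset.sum_sub_distrib]
  refine Finset.sum_congr rfl fun k _ => ?_
  refine (smul_sub _ _ _).symm.trans ?_
  rw [← Finset.sum_sub_distrib, map_sum, Finset.smul_sum]
  refine Finset.sum_congr rfl fun a _ => ?_
  rw [← map_mul, ← MvPolynomial.smul_eq_C_mul, map_smul, map_add, bracketEval_mul L hu hw hz,
    bracketEval_mul L hu hw hz, bracketEval_monomial, bracketEval_monomial,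
    scalarExt_bracket_skew L (adExt_pow_mem L hw hz a) (adExt_pow_mem L hu hz k), map_neg,
    sub_neg_eq_add]

theorem adExt_self [CharZero K] {z : Λ ⊗[K] g} (hz : z ∈ evenPoints ℒ 𝔤) : adExt L z z = 0 := by
  have h := scalarExt_bracket_skew L hz hz
  have h2 : (2 : K) • scalarExt Λ L.bracket z z = 0 := by
    rw [two_smul]
    exact eq_neg_iff_add_eq_zero.1 h
  exact (smul_eq_zero.1 h2).resolve_left two_ne_zero

variable [DirectSum.Decomposition 𝔤]
variable {X : Type*} [Fintype X] (b : Module.Basis X K g) {p : X → ZMod 2}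

theorem scalarExt_seriesAction_pow (hb : ∀ i, b i ∈ 𝔤 (p i)) (c : ℕ → K) {z : Λ ⊗[K] g}
    (hz : z ∈ evenPoints ℒ 𝔤) (w : Λ ⊗[K] g) (n : ℕ) :
    scalarExt Λ (seriesAction L b hb c) w (incl Λ 𝔤 z ^ n) = ∑ r ∈ Finset.range (n + 1),
      (c r * n.descFactorial r) • (incl Λ 𝔤 ((adExt L z ^ r) w) * incl Λ 𝔤 z ^ (n - r)) := by
  rw [scalarExt_seriesAction, lTensor_seriesEnd _ _ _ (n := n + 1), map_sum]
  · refine Finset.sum_congr rfl fun r _ => ?_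
    rw [lTensor_adDeriv_pow_pow L b hb hz, map_smul, map_nsmul, lTensor_mulMap_boxExt, mul_smul,
      Nat.cast_smul_eq_nsmul]
  · intro r hr
    rw [lTensor_adDeriv_pow_pow L b hb hz, Nat.descFactorial_of_lt (by omega), zero_smul]

theorem scalarExt_seriesAction_mul_pow (hb : ∀ i, b i ∈ 𝔤 (p i)) (c : ℕ → K)
    {v z : Λ ⊗[K] g} (hv : v ∈ evenPoints ℒ 𝔤) (hz : z ∈ evenPoints ℒ 𝔤) (w : Λ ⊗[K] g)
    (n : ℕ) :
    scalarExt Λ (seriesAction L b hb c) w (incl Λ 𝔤 v * incl Λ 𝔤 z ^ n) =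
      ∑ q ∈ Finset.range (n + 1), ((c q * n.descFactorial q) •
        (incl Λ 𝔤 ((adExt L z ^ q) w) * (incl Λ 𝔤 v * incl Λ 𝔤 z ^ (n - q))) +
      (c (q + 1) * n.descFactorial q) • (incl Λ 𝔤 (∑ a ∈ Finset.range (q + 1),
        (adExt L z ^ (q - a)) (adExt L v ((adExt L z ^ a) w))) * incl Λ 𝔤 z ^ (n - q))) := by
  have h0 : ∀ q, n + 1 ≤ q → n.descFactorial q = 0 := fun q hq =>
    Nat.descFactorial_of_lt (by omega)
  rw [scalarExt_seriesAction, lTensor_seriesEnd _ _ _ (n := n + 2), map_sum]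
  · simp only [lTensor_adDeriv_pow_mul_pow L b hb hv hz, map_smul, map_add, map_nsmul,
      lTensor_mulMap_boxExt, smul_add, Finset.sum_add_distrib]
    congr 1
    · rw [Finset.sum_range_succ, h0 _ le_rfl, zero_smul, smul_zero, add_zero]
      refine Finset.sum_congr rfl fun r _ => ?_
      rw [mul_smul, Nat.cast_smul_eq_nsmul]
    -- The term that consumes v starts at r = 1; the shift r = q + 1 gives the coefficient c (q +
    -- 1).
    · rw [Finset.sum_range_succ']
      simp only [Finset.range_zero, Finset.sum_empty, map_zero, zero_mul, smul_zero, add_zero,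
        Nat.add_sub_cancel]
      refine Finset.sum_congr rfl fun r _ => ?_
      rw [mul_smul, Nat.cast_smul_eq_nsmul]
  · intro r hr
    rw [lTensor_adDeriv_pow_mul_pow L b hb hv hz, h0 r (by omega), h0 (r - 1) (by omega),
      zero_smul, zero_smul, add_zero]

/-- The terms are grouped by the number k of factors z consumed. In the first sum the vectors
descended from u and w remain separate factors; in the second the vector descended from w has been
consumed by a bracket. -/
theorem scalarExt_seriesAction_seriesAction (hb : ∀ i, b i ∈ 𝔤 (p i)) (c : ℕ → K)
    {u w z : Λ ⊗[K] g} (hw : w ∈ evenPoints ℒ 𝔤) (hz : z ∈ evenPoints ℒ 𝔤) (n : ℕ) :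
    scalarExt Λ (seriesAction L b hb c) u
        (scalarExt Λ (seriesAction L b hb c) w (incl Λ 𝔤 z ^ n)) =
      ∑ k ∈ Finset.range (n + 1), (n.descFactorial k : K) • (∑ r ∈ Finset.range (k + 1),
        (c r * c (k - r)) • (incl Λ 𝔤 ((adExt L z ^ (k - r)) u) *
          (incl Λ 𝔤 ((adExt L z ^ r) w) * incl Λ 𝔤 z ^ (n - k)))) +
      ∑ k ∈ Finset.range (n + 1), (n.descFactorial k : K) •
        (incl Λ 𝔤 (bracketSum L c u w z k) * incl Λ 𝔤 z ^ (n - k)) := by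
  rw [scalarExt_seriesAction_pow L b hb c hz, map_sum]
  have h1 : ∀ r ∈ Finset.range (n + 1), scalarExt Λ (seriesAction L b hb c) u
      ((c r * n.descFactorial r) • (incl Λ 𝔤 ((adExt L z ^ r) w) * incl Λ 𝔤 z ^ (n - r))) =
      ∑ q ∈ Finset.range (n + 1 - r), (((c r * n.descFactorial r) *
          (c q * (n - r).descFactorial q)) • (incl Λ 𝔤 ((adExt L z ^ q) u) *
            (incl Λ 𝔤 ((adExt L z ^ r) w) * incl Λ 𝔤 z ^ (n - r - q))) +
        ((c r * n.descFactorial r) * (c (q + 1) * (n - r).descFactorial q)) •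
          (incl Λ 𝔤 (∑ a ∈ Finset.range (q + 1), (adExt L z ^ (q - a))
            (adExt L ((adExt L z ^ r) w) ((adExt L z ^ a) u))) *
              incl Λ 𝔤 z ^ (n - r - q))) := by
    intro r hr
    have hr' : n + 1 - r = n - r + 1 := by
      have := Finset.mem_range.1 hr
      omega
    rw [map_smul, scalarExt_seriesAction_mul_pow L b hb c (adExt_pow_mem L hw hz r) hz,
      Finset.smul_sum, hr']
    simp only [smul_add, smul_smul]
  rw [Finset.sum_congr rfl h1, ← Finset.sum_range_diag_flip, ← Finset.sum_add_distrib]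
  refine Finset.sum_congr rfl fun k _ => ?_
  rw [Finset.sum_add_distrib]
  have h2 : ∀ r ∈ Finset.range (k + 1),
      (n.descFactorial r : K) * (n - r).descFactorial (k - r) = n.descFactorial k ∧
        n - r - (k - r) = n - k := by
    intro r hr
    have hr' : r ≤ k := by have := Finset.mem_range.1 hr; omega
    refine ⟨?_, by omega⟩
    rw [← Nat.descFactorial_mul_descFactorial hr', Nat.cast_mul, mul_comm]
  congr 1
  · rw [Finset.smul_sum]
    refine Finset.sum_congr rfl fun r hr => ?_
    rw [(h2 r hr).2, smul_smul, ← (h2 r hr).1]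
    congr 1
    ring
  · rw [bracketSum, map_sum, Finset.sum_mul, Finset.smul_sum]
    refine Finset.sum_congr rfl fun r hr => ?_
    rw [(h2 r hr).2, map_smul, smul_mul_assoc, smul_smul, ← (h2 r hr).1]
    congr 1
    ring

theorem scalarExt_seriesAction_comm [CharZero K] (hb : ∀ i, b i ∈ 𝔤 (p i)) {u w z : Λ ⊗[K] g}
    (hu : u ∈ evenPoints ℒ 𝔤) (hw : w ∈ evenPoints ℒ 𝔤) (hz : z ∈ evenPoints ℒ 𝔤) (n : ℕ) :
    scalarExt Λ (seriesAction L b hb (bernoulliCoeff K)) u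
        (scalarExt Λ (seriesAction L b hb (bernoulliCoeff K)) w (incl Λ 𝔤 z ^ n)) -
      scalarExt Λ (seriesAction L b hb (bernoulliCoeff K)) w
        (scalarExt Λ (seriesAction L b hb (bernoulliCoeff K)) u (incl Λ 𝔤 z ^ n)) =
      scalarExt Λ (seriesAction L b hb (bernoulliCoeff K)) (scalarExt Λ L.bracket u w)
        (incl Λ 𝔤 z ^ n) := by
  rw [scalarExt_seriesAction_seriesAction L b hb _ hw hz,
    scalarExt_seriesAction_seriesAction L b hb _ hu hz, scalarExt_seriesAction_pow L b hb _ hz,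
    add_sub_add_comm]
  -- The part without a bracket of u with w is symmetric in them, since even points commute in Λ ⊗
  -- S(g), and drops out of the commutator.
  have h1 : ∀ k, ∑ r ∈ Finset.range (k + 1),
      (bernoulliCoeff K r * bernoulliCoeff K (k - r)) • (incl Λ 𝔤 ((adExt L z ^ (k - r)) u) *
        (incl Λ 𝔤 ((adExt L z ^ r) w) * incl Λ 𝔤 z ^ (n - k))) =
      ∑ r ∈ Finset.range (k + 1),
      (bernoulliCoeff K r * bernoulliCoeff K (k - r)) • (incl Λ 𝔤 ((adExt L z ^ (k - r)) w) *
        (incl Λ 𝔤 ((adExt L z ^ r) u) * incl Λ 𝔤 z ^ (n - k))) := by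
    intro k
    rw [← Finset.sum_flip]
    refine Finset.sum_congr rfl fun r hr => ?_
    have hr' : k - (k - r) = r := by have := Finset.mem_range.1 hr; omega
    rw [hr', mul_comm (bernoulliCoeff K r), ← mul_assoc, ← mul_assoc,
      (incl_commute (adExt_pow_mem L hu hz r) (adExt_pow_mem L hw hz (k - r))).eq]
  simp only [h1, sub_self, zero_add]
  rw [← Finset.sum_sub_distrib]
  refine Finset.sum_congr rfl fun k _ => ?_
  refine (smul_sub _ _ _).symm.trans ?_
  rw [← sub_mul, ← map_sub, bracketSum_sub L hu hw hz, map_smul, smul_mul_assoc,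
    smul_smul, mul_comm]

end Representation

open scoped TensorProduct

/-! ### The Grassmann algebra and its square-zero points -/

section Grassmann

variable {K M : Type*} [Field K] [AddCommGroup M] [Module K M]

instance supercommutative_evenOdd :
    Supercommutative (K := K) (Λ := ExteriorAlgebra K M)
      (CliffordAlgebra.evenOdd (0 : QuadraticForm K M)) where
  comm {i j a b} ha hb := by
    have h := CliffordAlgebra.map_mul_map_of_isOrtho_of_mem_evenOdd
      (QuadraticMap.Isometry.id (0 : QuadraticForm K M))
      (QuadraticMap.Isometry.id (0 : QuadraticForm K M)) (by intro x y; simp [QuadraticMap.IsOrtho])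
      a b ha hb
    simp only [CliffordAlgebra.map_id, AlgHom.id_apply] at h
    refine h.trans ?_
    rcases zmod_two_eq i with rfl | rfl <;> rcases zmod_two_eq j with rfl | rfl <;>
      simp [sgn_zero_left, sgn_zero_right, sgn_one_one]

variable (K) in
/-- The Grassmann algebra with generators indexed by `ℕ`. -/
noncomputable abbrev Grassmann := ExteriorAlgebra K (ℕ →₀ K)

variable (K) in
/-- The parity of the Grassmann algebra. -/
noncomputable abbrev grassmannGrading : ZMod 2 → Submodule K (Grassmann K) :=
  CliffordAlgebra.evenOdd (0 : QuadraticForm K (ℕ →₀ K))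

variable (K) in
/-- The generators of the Grassmann algebra. -/
noncomputable def grassmannGen (i : ℕ) : Grassmann K :=
  ExteriorAlgebra.ι K (Finsupp.single i 1)

/-- The determinant of the coordinates listed in `l` is an alternating form which takes the value
det 1 = 1 on the product. Only its member in degree `l.length` matters. -/
theorem prod_grassmannGen_ne_zero {l : List ℕ} (hl : l.Nodup) :
    (l.map (grassmannGen K)).prod ≠ 0 := by
  let f : ∀ i, (ℕ →₀ K) [⋀^Fin i]→ₗ[K] K := fun i =>
    (Matrix.detRowAlternating (n := Fin i) (R := K)).compLinearMap
      (LinearMap.pi fun k : Fin i => Finsupp.lapply (l.getD k 0))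
  intro h
  have h1 : (l.map (grassmannGen K)).prod = ExteriorAlgebra.ιMulti K l.length
      (fun k : Fin l.length => Finsupp.single (l.getD k 0) 1) := by
    rw [ExteriorAlgebra.ιMulti_apply, map_eq_ofFn _ _ rfl]
    simp [grassmannGen]
  rw [h1] at h
  have h2 := congrArg (ExteriorAlgebra.liftAlternating f) h
  rw [ExteriorAlgebra.liftAlternating_apply_ιMulti, map_zero] at h2
  have h3 : (fun k : Fin l.length => (LinearMap.pi fun k : Fin l.length =>
      Finsupp.lapply (l.getD k 0) : (ℕ →₀ K) →ₗ[K] (Fin l.length → K))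
        (Finsupp.single (l.getD k 0) 1)) = (1 : Matrix (Fin l.length) (Fin l.length) K) := by
    ext j k
    simp only [LinearMap.pi_apply, Finsupp.lapply_apply, Finsupp.single_apply, Matrix.one_apply,
      List.getD_eq_getElem _ _ j.2, List.getD_eq_getElem _ _ k.2, hl.getElem_inj_iff, Fin.ext_iff]
  have h4 : f l.length (fun k : Fin l.length => Finsupp.single (l.getD k 0) 1) =
      Matrix.det (1 : Matrix (Fin l.length) (Fin l.length) K) := by
    rw [← h3]; rfl
  rw [h4, Matrix.det_one] at h2
  exact one_ne_zero h2

/-- The indices of the generators whose product is `grassmannPoint p i`. -/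
def grassmannIndices (p : ZMod 2) (i : ℕ) : List ℕ := if p = 0 then [2 * i, 2 * i + 1] else [2 * i]

variable (K) in
/-- A square zero element of parity `p`. -/
noncomputable def grassmannPoint (p : ZMod 2) (i : ℕ) : Grassmann K :=
  ((grassmannIndices p i).map (grassmannGen K)).prod

theorem grassmannPoint_mem (p : ZMod 2) (i : ℕ) :
    grassmannPoint K p i ∈ grassmannGrading K p := by
  rcases zmod_two_eq p with rfl | rfl
  · have h : grassmannPoint K 0 i = grassmannGen K (2 * i) * grassmannGen K (2 * i + 1) := by
      simp [grassmannPoint, grassmannIndices]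
    rw [h]
    exact CliffordAlgebra.ι_mul_ι_mem_evenOdd_zero (0 : QuadraticForm K (ℕ →₀ K)) _ _
  · have h : grassmannPoint K 1 i = grassmannGen K (2 * i) := by
      simp [grassmannPoint, grassmannIndices]
    rw [h]
    exact CliffordAlgebra.ι_mem_evenOdd_one (0 : QuadraticForm K (ℕ →₀ K)) _

theorem grassmannGen_mul_self (i : ℕ) : grassmannGen K i * grassmannGen K i = 0 :=
  ExteriorAlgebra.ι_sq_zero _

theorem grassmannPoint_mul_self (p : ZMod 2) (i : ℕ) :
    grassmannPoint K p i * grassmannPoint K p i = 0 := by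
  rcases zmod_two_eq p with rfl | rfl
  · have h := Supercommutative.comm (ℒ := grassmannGrading K)
      (CliffordAlgebra.ι_mem_evenOdd_one (0 : QuadraticForm K (ℕ →₀ K)) (Finsupp.single (2 * i) 1))
      (grassmannPoint_mem 0 i)
    have h' : grassmannGen K (2 * i) * grassmannPoint K 0 i =
        grassmannPoint K 0 i * grassmannGen K (2 * i) := by
      rw [sgn_zero_right, one_smul] at h; exact h
    have h0 : grassmannPoint K 0 i = grassmannGen K (2 * i) * grassmannGen K (2 * i + 1) := by
      simp [grassmannPoint, grassmannIndices]
    have h1 : grassmannPoint K 0 i * grassmannGen K (2 * i) = 0 := by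
      rw [← h', h0, ← mul_assoc, grassmannGen_mul_self, zero_mul]
    conv_lhs => rw [h0]
    rw [← h0]
    nth_rw 2 [h0]
    rw [← mul_assoc, h1, zero_mul]
  · simp [grassmannPoint, grassmannIndices, grassmannGen_mul_self]

theorem nodup_flatten_grassmannIndices (n : ℕ) (p : Fin n → ZMod 2) :
    (List.ofFn fun k : Fin n => grassmannIndices (p k) k).flatten.Nodup := by
  rw [List.nodup_flatten]
  constructor
  · intro l hl
    obtain ⟨k, rfl⟩ := (List.mem_ofFn' _ _).1 hl
    dsimp only [grassmannIndices]
    split_ifs <;> simp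
  · rw [List.pairwise_ofFn]
    intro i j hij
    rw [List.disjoint_left]
    intro a ha hb
    unfold grassmannIndices at ha hb
    have : i.val < j.val := hij
    split_ifs at ha hb <;> simp at ha hb <;> omega

theorem prod_grassmannPoint_ne_zero (n : ℕ) (p : Fin n → ZMod 2) :
    (List.ofFn fun k : Fin n => grassmannPoint K (p k) k).prod ≠ 0 := by
  have h := prod_grassmannGen_ne_zero (K := K) (nodup_flatten_grassmannIndices n p)
  rw [List.map_flatten, List.prod_flatten, List.map_map, List.map_ofFn] at h
  exact h

end Grassmann

/-! ### Polarisation: even powers detect linear maps -/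

section Polarisation

theorem add_pow_of_mul_self_eq_zero {R : Type*} [Ring R] {a s : R} (h : Commute a s)
    (ha : a * a = 0) (n : ℕ) : (a + s) ^ n = s ^ n + n • (a * s ^ (n - 1)) := by
  induction n with
  | zero => simp
  | succ n ih =>
    have h1 : a * (n • (a * s ^ (n - 1))) = 0 := by
      rw [mul_smul_comm, ← mul_assoc, ha, zero_mul, smul_zero]
    have h2 : s * (n • (a * s ^ (n - 1))) = n • (a * s ^ n) := by
      rcases n with _ | n
      · simp
      · rw [mul_smul_comm, ← mul_assoc, ← h.eq, mul_assoc, ← pow_succ', Nat.add_sub_cancel]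
    rw [pow_succ', ih, add_mul, mul_add, mul_add, h1, h2, ← pow_succ', Nat.add_sub_cancel,
      succ_nsmul]
    abel

/-- Monomials with a repeated factor vanish, which leaves the n! orderings of the full product. The
vanishing of the next power is carried along because the induction needs it. -/
theorem sum_pow_of_mul_self_eq_zero {R : Type*} [Ring R] {n : ℕ} (w : Fin n → R)
    (hc : ∀ i j, Commute (w i) (w j)) (hw : ∀ i, w i * w i = 0) :
    (∑ i, w i) ^ n = n.factorial • (List.ofFn w).prod ∧ (∑ i, w i) ^ (n + 1) = 0 := by
  induction n with
  | zero => simp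
  | succ n ih =>
    obtain ⟨h1, h2⟩ := ih (fun i => w i.succ) (fun i j => hc _ _) (fun i => hw _)
    have hc' : Commute (w 0) (∑ i : Fin n, w i.succ) :=
      Commute.sum_right _ _ _ fun i _ => hc _ _
    rw [Fin.sum_univ_succ]
    constructor
    · rw [add_pow_of_mul_self_eq_zero hc' (hw 0), h2, zero_add, Nat.add_sub_cancel, h1,
        List.ofFn_succ, List.prod_cons, mul_smul_comm, smul_smul, Nat.factorial_succ]
    · rw [add_pow_of_mul_self_eq_zero hc' (hw 0), pow_succ, h2, zero_mul, zero_add,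
        Nat.add_sub_cancel, h2, mul_zero, smul_zero]

theorem eq_zero_of_tmul_eq_zero {K A M : Type*} [Field K] [AddCommGroup A] [Module K A]
    [AddCommGroup M] [Module K M] {a : A} (ha : a ≠ 0) {m : M} (h : a ⊗ₜ[K] m = 0) : m = 0 := by
  obtain ⟨φ, hφ⟩ : ∃ φ : Module.Dual K A, φ a ≠ 0 := by
    by_contra! h'
    exact ha ((Module.forall_dual_apply_eq_zero_iff K a).1 h')
  have h1 := congrArg (TensorProduct.lid K M ∘ φ.rTensor M) h
  simpa [hφ] using h1

variable {K V M : Type*} [Field K] [CharZero K] [AddCommGroup V] [Module K V] [AddCommGroup M]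
  [Module K M] (𝒱 : ZMod 2 → Submodule K V)

/-- A linear map on `S(V)` vanishes if it vanishes on the powers of even points with coefficients in
the Grassmann algebra, up to multiplication by homogeneous Grassmann elements. -/
theorem eq_zero_of_evenPoints [DirectSum.Decomposition 𝒱] (G : SSym 𝒱 →ₗ[K] M) (i j : ZMod 2)
    (h : ∀ e ∈ grassmannGrading K i, ∀ f ∈ grassmannGrading K j,
      ∀ z ∈ evenPoints (grassmannGrading K) 𝒱, ∀ n : ℕ,
        (LinearMap.mulLeft K (e * f)).rTensor M
          (G.lTensor (Grassmann K) (incl (Grassmann K) 𝒱 z ^ n)) = 0) : G = 0 := by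
  have key : ∀ l : List V, (∀ x ∈ l, ∃ i, x ∈ 𝒱 i) → G (l.map (SSym.ι 𝒱)).prod = 0 := by
    intro l hl
    obtain ⟨n, v, rfl⟩ : ∃ (n : ℕ) (v : Fin n → V), l = List.ofFn v :=
      ⟨l.length, l.get, (List.ofFn_get l).symm⟩
    have : ∀ k, ∃ p, v k ∈ 𝒱 p := fun k => hl _ ((List.mem_ofFn' v _).2 ⟨k, rfl⟩)
    choose p hp using this
    -- The Grassmann points 0 and 1 are kept for the multipliers `e` and `f`. The shift by 2 makes
    -- all the generators distinct, so the total coefficient is nonzero and can be cancelled.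
    let w : Fin n → Grassmann K ⊗[K] V := fun k => grassmannPoint K (p k) (k + 2) ⊗ₜ v k
    have hw : ∀ k, w k ∈ evenPoints (grassmannGrading K) 𝒱 := fun k =>
      tmul_mem_evenPoints (grassmannPoint_mem _ _) (hp k)
    have h1 := h _ (grassmannPoint_mem i 0) _ (grassmannPoint_mem j 1) (∑ k, w k)
      (sum_mem fun k _ => hw k) n
    rw [map_sum, (sum_pow_of_mul_self_eq_zero (fun k => incl (Grassmann K) 𝒱 (w k))
      (fun k l => incl_commute (hw k) (hw l)) (fun k => by
        simp only [w, incl_tmul, Algebra.TensorProduct.tmul_mul_tmul, grassmannPoint_mul_self,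
          TensorProduct.zero_tmul])).1] at h1
    simp only [w, incl_tmul] at h1
    rw [prod_ofFn_tmul, map_nsmul, map_nsmul, LinearMap.lTensor_tmul, LinearMap.rTensor_tmul,
      LinearMap.mulLeft_apply, ← Nat.cast_smul_eq_nsmul K, smul_eq_zero] at h1
    have h2 := h1.resolve_left (by exact_mod_cast n.factorial_ne_zero)
    have h3 : grassmannPoint K i 0 * grassmannPoint K j 1 *
        (List.ofFn fun k : Fin n => grassmannPoint K (p k) (k + 2)).prod ≠ 0 := by
      have := prod_grassmannPoint_ne_zero (K := K) (n + 2) (Fin.cons i (Fin.cons j p))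
      simpa [List.ofFn_succ, mul_assoc, add_assoc] using this
    rw [List.map_ofFn]
    exact eq_zero_of_tmul_eq_zero h3 h2
  have key' : ∀ a (l : List V), (∀ x ∈ l, ∃ i, x ∈ 𝒱 i) →
      G ((l.map (SSym.ι 𝒱)).prod * a) = 0 := by
    intro a
    induction a using SSym.induction 𝒱 with
    | one => simpa using key
    | ι_mul x a ha =>
      intro l hl
      have : ∀ i, G ((l.map (SSym.ι 𝒱)).prod * (SSym.ι 𝒱 (homPart 𝒱 i x) * a)) = 0 := by
        intro i
        have := ha (l ++ [homPart 𝒱 i x]) (by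
          intro y hy
          rcases List.mem_append.1 hy with hy | hy
          · exact hl y hy
          · exact ⟨i, by rw [List.mem_singleton.1 hy]; exact homPart_mem 𝒱 i x⟩)
        simpa [mul_assoc] using this
      rw [← homPart_add 𝒱 x, map_add, add_mul, mul_add, map_add, this, this, add_zero]
    | add a b ha hb =>
      intro l hl
      rw [mul_add, map_add, ha l hl, hb l hl, add_zero]
    | smul c a ha =>
      intro l hl
      rw [mul_smul_comm, map_smul, ha l hl, smul_zero]
  ext a
  simpa using key' a [] (by simp)

end Polarisation

open scoped TensorProduct

/-! ### The representation on S(g) and the inverse of σ -/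

section Action

variable {K g : Type*} [Field K] [CharZero K] [AddCommGroup g] [Module K g]
variable {𝔤 : ZMod 2 → Submodule K g} [DirectSum.Decomposition 𝔤] (L : LieSuperalgebra 𝔤)
variable {X : Type*} [Fintype X] (b : Module.Basis X K g) {p : X → ZMod 2}

/-- The operators `seriesAction`, with the Bernoulli coefficients, represent `g` on `S(g)`. -/
theorem seriesAction_bracket (hb : ∀ i, b i ∈ 𝔤 (p i)) {i j : ZMod 2} {x y : g} (hx : x ∈ 𝔤 i)
    (hy : y ∈ 𝔤 j) : seriesAction L b hb (bernoulliCoeff K) (L.bracket x y) =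
      seriesAction L b hb (bernoulliCoeff K) x ∘ₗ seriesAction L b hb (bernoulliCoeff K) y -
      sgn K i j • (seriesAction L b hb (bernoulliCoeff K) y ∘ₗ
        seriesAction L b hb (bernoulliCoeff K) x) := by
  symm
  rw [← sub_eq_zero]
  refine eq_zero_of_evenPoints 𝔤 _ i j fun e he f hf z hz n => ?_
  -- Multiplied by coefficients of their own parities, x and y become even points. The ordinary
  -- commutator of the resulting operators is e f times the supercommutator.
  have h1 := scalarExt_seriesAction_comm L b hb (tmul_mem_evenPoints he hx)
    (tmul_mem_evenPoints hf hy) hz n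
  rw [← sub_eq_zero] at h1
  rw [← h1]
  generalize incl (Grassmann K) 𝔤 z ^ n = u
  generalize seriesAction L b hb (bernoulliCoeff K) = π
  induction u using TensorProduct.induction_on with
  | zero => simp
  | add u v hu hv => simp only [map_add, hu, hv]; abel
  | tmul a u =>
    simp only [LinearMap.lTensor_tmul, LinearMap.rTensor_tmul, scalarExt_tmul,
      LinearMap.mulLeft_apply, LinearMap.sub_apply, LinearMap.smul_apply, LinearMap.comp_apply,
      TensorProduct.tmul_sub, TensorProduct.tmul_smul, map_sub, map_smul, ← mul_assoc]
    rw [Supercommutative.comm (ℒ := grassmannGrading K) hf he, smul_mul_assoc, sgn_comm j i,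
      TensorProduct.smul_tmul']

/-- The action of the enveloping algebra on `S(g)` through the operators `seriesAction`. -/
noncomputable def envAction (hb : ∀ i, b i ∈ 𝔤 (p i)) :
    L.Env →ₐ[K] Module.End K (SSym 𝔤) :=
  L.envLift (A := Module.End K (SSym 𝔤)) (seriesAction L b hb (bernoulliCoeff K))
    fun _ _ _ _ hx hy => seriesAction_bracket L b hb hx hy

/-- The map `u ↦ u • 1` from `U(g)` to `S(g)`. -/
noncomputable def envEval (hb : ∀ i, b i ∈ 𝔤 (p i)) : L.Env →ₗ[K] SSym 𝔤 :=
  (LinearMap.applyₗ (1 : SSym 𝔤)) ∘ₗ (envAction L b hb).toLinearMap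

theorem envEval_one (hb : ∀ i, b i ∈ 𝔤 (p i)) : envEval L b hb 1 = 1 := by
  simp [envEval]

theorem envEval_ι_mul (hb : ∀ i, b i ∈ 𝔤 (p i)) (x : g) (u : L.Env) :
    envEval L b hb (L.ι x * u) =
      seriesAction L b hb (bernoulliCoeff K) x (envEval L b hb u) := by
  simp [envEval, envAction, L.envLift_ι]

variable {Λ : Type*} [Ring Λ] [Algebra K Λ]

theorem lTensor_envEval_mul (hb : ∀ i, b i ∈ 𝔤 (p i)) (z : Λ ⊗[K] g) (u : Λ ⊗[K] L.Env) :
    (envEval L b hb).lTensor Λ (L.ι.lTensor Λ z * u) =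
      scalarExt Λ (seriesAction L b hb (bernoulliCoeff K)) z
        ((envEval L b hb).lTensor Λ u) := by
  induction z using TensorProduct.induction_on with
  | zero => simp
  | add z w hz hw => simp only [map_add, add_mul, LinearMap.add_apply, hz, hw]
  | tmul e x =>
    induction u using TensorProduct.induction_on with
    | zero => simp
    | add u v hu hv => simp only [map_add, mul_add, hu, hv]
    | tmul f u => simp [envEval_ι_mul]

variable {ℒ : ZMod 2 → Submodule K Λ} [Supercommutative ℒ]

/-- All terms with r ≥ 1 contain [z, z] = 0, and c_0 = 1. -/
theorem scalarExt_seriesAction_self (hb : ∀ i, b i ∈ 𝔤 (p i)) {z : Λ ⊗[K] g}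
    (hz : z ∈ evenPoints ℒ 𝔤) (n : ℕ) :
    scalarExt Λ (seriesAction L b hb (bernoulliCoeff K)) z (incl Λ 𝔤 z ^ n) =
      incl Λ 𝔤 z ^ (n + 1) := by
  rw [scalarExt_seriesAction_pow L b hb _ hz, Finset.sum_range_succ', Finset.sum_eq_zero]
  · simp [bernoulliCoeff, pow_succ']
  · intro r _
    rw [pow_succ, Module.End.mul_apply, adExt_self L hz, map_zero, map_zero, zero_mul, smul_zero]

theorem lTensor_envEval_pow (hb : ∀ i, b i ∈ 𝔤 (p i)) {z : Λ ⊗[K] g}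
    (hz : z ∈ evenPoints ℒ 𝔤) (n : ℕ) :
    (envEval L b hb).lTensor Λ (L.ι.lTensor Λ z ^ n) = incl Λ 𝔤 z ^ n := by
  induction n with
  | zero => simp [Algebra.TensorProduct.one_def, envEval_one]
  | succ n ih =>
    rw [pow_succ', lTensor_envEval_mul, ih, scalarExt_seriesAction_self L b hb hz]

theorem envEval_sym (hb : ∀ i, b i ∈ 𝔤 (p i)) (y : SSym 𝔤) : envEval L b hb (L.sym y) = y := by
  have h : envEval L b hb ∘ₗ L.sym - LinearMap.id = 0 := by
    refine eq_zero_of_evenPoints 𝔤 _ 0 0 fun e _ f _ z hz n => ?_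
    have h1 : L.sym.lTensor (Grassmann K) (incl (Grassmann K) 𝔤 z ^ n) =
        L.ι.lTensor (Grassmann K) z ^ n := by
      obtain ⟨ζ, hζ, rfl⟩ := exists_eq_sum_of_mem_evenPoints b hb hz
      have := symmetrisation_pow 𝔤 L.ι p ζ
        (fun i j => Supercommutative.comm (hζ i) (hζ j)) b hb n
      simp only [map_sum, incl_tmul, LinearMap.lTensor_tmul]
      exact this
    rw [LinearMap.lTensor_sub, LinearMap.sub_apply, LinearMap.lTensor_comp, LinearMap.comp_apply,
      h1, lTensor_envEval_pow L b hb hz, LinearMap.lTensor_id, LinearMap.id_apply, sub_self,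
      map_zero]
  exact sub_eq_zero.1 (LinearMap.congr_fun h y)

/-- Injectivity comes from the explicit left inverse `envEval`, so the Poincaré–Birkhoff–Witt
theorem is a consequence here and not an ingredient. -/
theorem sym_bijective (hb : ∀ i, b i ∈ 𝔤 (p i)) : Function.Bijective L.sym :=
  ⟨Function.LeftInverse.injective (envEval_sym L b hb), L.sym_surjective⟩

/-- As σ is onto, its left inverse `envEval` is σ⁻¹, and by construction it intertwines left
multiplication with π. -/
theorem leftAction_eq_seriesAction (hb : ∀ i, b i ∈ 𝔤 (p i)) (hσ : Function.Bijective L.sym)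
    (x : g) : L.leftAction hσ x = seriesAction L b hb (bernoulliCoeff K) x := by
  ext y
  have h : ∀ u, (LinearEquiv.ofBijective L.sym hσ).symm u = envEval L b hb u := by
    intro u
    obtain ⟨v, rfl⟩ := L.sym_surjective u
    rw [envEval_sym, LinearEquiv.symm_apply_eq]
    rfl
  simp only [LieSuperalgebra.leftAction, LinearMap.comp_apply, LinearEquiv.coe_coe, h,
    LinearMap.mulLeft_apply, envEval_ι_mul, envEval_sym]

end Action

open scoped TensorProduct

/-! ### Multi-indices and the multinomial theorem -/

namespace MultiIndex

variable {m n : ℕ}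

/-- The indices of the factors of the monomial of a multi-index. -/
def toList (k : MultiIndex m n) : List (Fin m ⊕ Fin n) :=
  (List.ofFn fun i => List.replicate (k.1 i) (Sum.inl i)).flatten ++
    (List.ofFn fun j => List.replicate (k.2 j : ℕ) (Sum.inr j)).flatten

theorem monomial_eq_prod_toList {M : Type*} [Monoid M] (k : MultiIndex m n)
    (a : Fin m ⊕ Fin n → M) : k.monomial a = (k.toList.map a).prod := by
  simp [monomial, toList, List.map_flatten, List.prod_flatten, List.map_ofFn, Function.comp_def]

theorem length_toList (k : MultiIndex m n) : k.toList.length = k.length := by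
  simp [toList, length, List.length_flatten, List.map_ofFn, Function.comp_def, List.sum_ofFn]

theorem map_monomial {M N F : Type*} [Monoid M] [Monoid N] [FunLike F M N]
    [MonoidHomClass F M N] (f : F) (k : MultiIndex m n) (a : Fin m ⊕ Fin n → M) :
    f (k.monomial a) = k.monomial fun i => f (a i) := by
  rw [monomial_eq_prod_toList, monomial_eq_prod_toList, map_list_prod, List.map_map]
  rfl

theorem finite_length_le (r : ℕ) : {k : MultiIndex m n | k.length ≤ r}.Finite := by
  refine ((Set.Finite.pi' fun _ : Fin m => Set.finite_Iic r).prod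
    (Set.finite_univ (α := Fin n → Fin 2))).subset ?_
  intro k hk
  refine ⟨fun i => ?_, trivial⟩
  have h1 : k.1 i ≤ ∑ i, k.1 i :=
    Finset.single_le_sum (f := k.1) (fun _ _ => Nat.zero_le _) (Finset.mem_univ i)
  have h2 : MultiIndex.length k ≤ r := hk
  unfold length at h2
  exact Set.mem_Iic.2 (by omega)

/-- The multi-indices of length `r`. -/
noncomputable def ofLength (m n r : ℕ) : Finset (MultiIndex m n) :=
  ((finite_length_le (m := m) (n := n) r).subset fun _ h => le_of_eq h :
    {k : MultiIndex m n | k.length = r}.Finite).toFinset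

@[simp] theorem mem_ofLength {r : ℕ} {k : MultiIndex m n} : k ∈ ofLength m n r ↔ k.length = r := by
  simp [ofLength]

theorem factorial_ne_zero (k : MultiIndex m n) : k.factorial ≠ 0 :=
  Finset.prod_ne_zero_iff.2 fun _ _ => Nat.factorial_ne_zero _

/-- The multinomial theorem, for odd variables with square zero. -/
theorem sum_pow_eq_sum_monomial_of_comm {K R : Type*} [Field K] [CharZero K] [CommRing R]
    [Algebra K R] (a : Fin m ⊕ Fin n → R) (ha : ∀ j, a (Sum.inr j) * a (Sum.inr j) = 0) (r : ℕ) :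
    (∑ i, a i) ^ r = ∑ k ∈ ofLength m n r,
      ((r.factorial : K) / (k.factorial : K)) • k.monomial a := by
  classical
  rw [Finset.sum_pow_eq_sum_piAntidiag]
  symm
  let e : MultiIndex m n → Fin m ⊕ Fin n → ℕ := fun k => Sum.elim k.1 fun j => (k.2 j : ℕ)
  have hsum : ∀ k : MultiIndex m n, ∑ i, e k i = k.length := by
    intro k; simp [e, length]
  refine Finset.sum_of_injOn e ?_ ?_ ?_ ?_
  · intro k _ k' _ h
    refine Prod.ext (funext fun i => ?_) (funext fun j => Fin.ext ?_)
    · exact congrFun h (Sum.inl i)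
    · exact congrFun h (Sum.inr j)
  · intro k hk
    simp only [Finset.mem_coe, mem_ofLength, Finset.mem_piAntidiag] at hk ⊢
    exact ⟨(hsum k).trans hk, fun i _ => Finset.mem_univ i⟩
  -- An exponent that is not a multi-index is at least 2 at some odd variable, whose square is zero.
  · intro l hl hl'
    have : ∃ j, 2 ≤ l (Sum.inr j) := by
      by_contra! h
      refine hl' ⟨(fun i => l (Sum.inl i), fun j => ⟨l (Sum.inr j), h j⟩), ?_, ?_⟩
      · simp only [Finset.mem_coe, mem_ofLength, ← hsum]
        rw [Finset.mem_piAntidiag] at hl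
        rw [← hl.1]
        refine Finset.sum_congr rfl fun i _ => ?_
        rcases i with i | i <;> rfl
      · funext i
        rcases i with i | i <;> rfl
    obtain ⟨j, hj⟩ := this
    rw [Finset.prod_eq_zero (Finset.mem_univ (Sum.inr j)), mul_zero]
    rw [← Nat.sub_add_cancel hj, pow_add, pow_two, ha, mul_zero]
  · intro k hk
    rw [mem_ofLength] at hk
    have h1 := Nat.multinomial_spec Finset.univ (e k)
    have h2 : ∏ i, (e k i).factorial = k.factorial := by
      rw [Fintype.prod_sum_type]
      have : ∏ j, (e k (Sum.inr j)).factorial = 1 := by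
        refine Finset.prod_eq_one fun j _ => ?_
        simp only [e, Sum.elim_inr]
        exact Nat.factorial_eq_one.2 (by omega)
      rw [this, mul_one]
      rfl
    rw [hsum, hk, h2] at h1
    have h3 : (r.factorial : K) / (k.factorial : K) =
        (Nat.multinomial Finset.univ (e k) : K) := by
      rw [div_eq_iff (by exact_mod_cast k.factorial_ne_zero), ← h1]
      push_cast
      ring
    have h4 : k.monomial a = ∏ i, a i ^ e k i := by
      rw [Fintype.prod_sum_type, monomial, List.prod_ofFn, List.prod_ofFn]
      rfl
    rw [h3, h4, Nat.cast_smul_eq_nsmul, nsmul_eq_mul]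

/-- Commuting elements generate a commutative subalgebra, where the commutative case applies. -/
theorem sum_pow_eq_sum_monomial {K R : Type*} [Field K] [CharZero K] [Ring R] [Algebra K R]
    (a : Fin m ⊕ Fin n → R) (hc : ∀ i j, Commute (a i) (a j))
    (ha : ∀ j, a (Sum.inr j) * a (Sum.inr j) = 0) (r : ℕ) :
    (∑ i, a i) ^ r = ∑ k ∈ ofLength m n r,
      ((r.factorial : K) / (k.factorial : K)) • k.monomial a := by
  have : IsMulCommutative (Algebra.adjoin K (Set.range a)) :=
    Algebra.isMulCommutative_adjoin K (by
      rintro _ ⟨i, rfl⟩ _ ⟨j, rfl⟩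
      exact hc i j)
  let _ : CommRing (Algebra.adjoin K (Set.range a)) :=
    { Subalgebra.toRing _ with mul_comm := fun x y => IsMulCommutative.is_comm.comm x y }
  let a' : Fin m ⊕ Fin n → Algebra.adjoin K (Set.range a) := fun i =>
    ⟨a i, Algebra.subset_adjoin ⟨i, rfl⟩⟩
  have h := congrArg (Algebra.adjoin K (Set.range a)).val
    (sum_pow_eq_sum_monomial_of_comm (K := K) a' (fun j => Subtype.ext (ha j)) r)
  rw [map_pow, map_sum, map_sum] at h
  refine h.trans (Finset.sum_congr rfl fun k _ => ?_)
  rw [map_smul, map_monomial]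
  rfl

end MultiIndex

open scoped TensorProduct

/-! ### Coefficients of ad_z and of iterated derivatives -/

section Monomials

variable {K g : Type*} [Field K] [AddCommGroup g] [Module K g]
variable {𝔤 : ZMod 2 → Submodule K g} (L : LieSuperalgebra 𝔤)
variable {X : Type*} [Fintype X] (b : Module.Basis X K g) {p : X → ZMod 2}
variable {Λ : Type*} [Ring Λ] [Algebra K Λ]

open MulOpposite in
/-- The action of `Λᵒᵖ ⊗ End(g)` on `Λ ⊗ g`, with `Λᵒᵖ` acting by right multiplication. -/
noncomputable def oppositeAction (K Λ g : Type*) [Field K] [AddCommGroup g] [Module K g] [Ring Λ]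
    [Algebra K Λ] : Λᵐᵒᵖ ⊗[K] Module.End K g →ₐ[K] Module.End K (Λ ⊗[K] g) :=
  Algebra.TensorProduct.lift
    (AlgHom.ofLinearMap
      ((LinearMap.rTensorHom g) ∘ₗ (LinearMap.mul K Λ).flip ∘ₗ (opLinearEquiv K).symm.toLinearMap)
      (by ext; simp) (fun a a' => by ext; simp [mul_assoc]))
    (AlgHom.ofLinearMap (LinearMap.lTensorHom Λ) (by ext; simp) (fun T T' => by ext; simp))
    (by
      intro a T
      rw [commute_iff_eq]
      ext
      simp)

theorem oppositeAction_tmul (a : Λᵐᵒᵖ) (T : Module.End K g) (e : Λ) (x : g) :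
    oppositeAction K Λ g (a ⊗ₜ T) (e ⊗ₜ x) = (e * a.unop) ⊗ₜ T x := by
  rw [oppositeAction, Algebra.TensorProduct.lift_tmul, Module.End.mul_apply]
  rfl

/-- The operator ad_z multiplies coefficients from the right, hence the opposite algebra. Written in
this way, ad_z is the image under an algebra morphism of an element to which `symmetrisation_pow`
applies. -/
theorem oppositeAction_sum (ζ : X → Λ) :
    oppositeAction K Λ g (∑ i, MulOpposite.op (ζ i) ⊗ₜ L.adTilde (b i)) =
      adExt L (∑ i, ζ i ⊗ₜ b i) := by
  refine TensorProduct.ext' fun e x => ?_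
  rw [map_sum, LinearMap.sum_apply, adExt_apply, map_sum]
  refine Finset.sum_congr rfl fun i _ => ?_
  rw [oppositeAction_tmul, scalarExt_tmul]
  rfl

theorem list_prod_tmul {A B Y : Type*} [Ring A] [Algebra K A] [Ring B] [Algebra K B]
    (e : Y → A) (a : Y → B) (l : List Y) :
    (l.map fun i => e i ⊗ₜ[K] a i).prod = (l.map e).prod ⊗ₜ[K] (l.map a).prod := by
  induction l with
  | nil => simp [Algebra.TensorProduct.one_def]
  | cons x l ih => simp [ih]

theorem eq_zero_of_eq_neg_one_smul {K M : Type*} [Field K] [CharZero K] [AddCommGroup M] [Module K M] {y : M}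
    (h : y = (-1 : K) • y) : y = 0 := by
  have h2 : (2 : K) • y = 0 := by
    rw [two_smul]
    nth_rw 1 [h]
    rw [neg_smul, one_smul, neg_add_cancel]
  exact (smul_eq_zero.1 h2).resolve_left two_ne_zero

theorem ι_mul_self_of_odd [CharZero K] {x : g} (hx : x ∈ 𝔤 1) : SSym.ι 𝔤 x * SSym.ι 𝔤 x = 0 := by
  have h := SSym.ι_comm 𝔤 hx hx
  rw [sgn_one_one] at h
  exact eq_zero_of_eq_neg_one_smul h

variable [DirectSum.Decomposition 𝔤] {ℒ : ZMod 2 → Submodule K Λ} [Supercommutative ℒ]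

/-- Each outer derivative places its coefficient to the right of the earlier ones. The resulting
order is that of the opposite algebra, as in `adExt_pow_eq_sum`, so the two match without a sign. -/
theorem lTensor_list_prod_pderiv (hb : ∀ i, b i ∈ 𝔤 (p i)) (ζ : X → Λ)
    (hζ : ∀ i, ζ i ∈ ℒ (p i)) (n : ℕ) (l : List X) :
    ((l.map fun i => pderiv 𝔤 (b.coord i)).prod).lTensor Λ (incl Λ 𝔤 (∑ k, ζ k ⊗ₜ b k) ^ n) =
      n.descFactorial l.length • (((l.map fun i => MulOpposite.op (ζ i)).prod.unop ⊗ₜ 1) *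
        incl Λ 𝔤 (∑ k, ζ k ⊗ₜ b k) ^ (n - l.length)) := by
  have hmul : ∀ (D : Module.End K (SSym 𝔤)) (c : Λ) (y : Λ ⊗[K] SSym 𝔤),
      D.lTensor Λ ((c ⊗ₜ 1) * y) = (c ⊗ₜ 1) * D.lTensor Λ y := by
    intro D c y
    induction y using TensorProduct.induction_on with
    | zero => simp
    | add y y' hy hy' => simp only [mul_add, map_add, hy, hy']
    | tmul f y => simp
  induction l with
  | nil =>
    rw [List.map_nil, List.map_nil, List.prod_nil, List.prod_nil, Module.End.one_eq_id,
      LinearMap.lTensor_id]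
    simp [← Algebra.TensorProduct.one_def]
  | cons i l ih =>
    rw [List.map_cons, List.prod_cons, LinearMap.lTensor_mul, Module.End.mul_apply, ih,
      map_nsmul, hmul, lTensor_pderiv_pow b ζ hb hζ, mul_smul_comm, smul_smul, ← mul_assoc,
      Algebra.TensorProduct.tmul_mul_tmul, List.length_cons, Nat.descFactorial_succ,
      mul_comm (n - l.length), Nat.sub_sub]
    simp

end Monomials

/-! ### Finiteness of the sum over multi-indices -/

section Finiteness

variable {K g : Type*} [Field K] [AddCommGroup g] [Module K g]
variable {𝔤 : ZMod 2 → Submodule K g} [DirectSum.Decomposition 𝔤]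
variable {m n : ℕ} (b : Module.Basis (Fin m ⊕ Fin n) K g) {p : Fin m ⊕ Fin n → ZMod 2}

theorem partialK_eq_zero (hb : ∀ i, b i ∈ 𝔤 (p i)) {N : ℕ} {y : SSym 𝔤}
    (hy : y ∈ symFiltration 𝔤 N) {k : MultiIndex m n} (hk : N ≤ k.length) :
    partialK b 𝔤 k y = 0 := by
  rw [partialK, MultiIndex.monomial_eq_prod_toList]
  rw [← MultiIndex.length_toList] at hk
  have key : ∀ (l : List (Fin m ⊕ Fin n)) (M : ℕ), y ∈ symFiltration 𝔤 (l.length + M) →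
      (l.map fun i => pderiv 𝔤 (b.coord i)).prod y ∈ symFiltration 𝔤 M := by
    intro l
    induction l with
    | nil => intro M hM; simpa using hM
    | cons i l ih =>
      intro M hM
      rw [List.map_cons, List.prod_cons, Module.End.mul_apply]
      refine pderiv_mem_symFiltration b hb i (ih (M + 1) ?_)
      rw [List.length_cons] at hM
      rwa [add_assoc, add_comm 1 M] at hM
  have h := key k.toList 0 (symFiltration_mono 𝔤 hk hy)
  rwa [symFiltration_zero, Submodule.mem_bot] at h

theorem finite_partialK_ne_zero (hb : ∀ i, b i ∈ 𝔤 (p i)) (y : SSym 𝔤) :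
    {k : MultiIndex m n | partialK b 𝔤 k y ≠ 0}.Finite := by
  obtain ⟨N, hN⟩ := exists_mem_symFiltration 𝔤 y
  refine (MultiIndex.finite_length_le N).subset fun k hk => ?_
  by_contra h
  exact hk (partialK_eq_zero b hb hN (not_le.1 h).le)

end Finiteness

/-! ### The formula in terms of s^K and ∂^K -/

section BerezinFormula

variable {K g : Type*} [Field K] [CharZero K] [AddCommGroup g] [Module K g]
variable {𝔤 : ZMod 2 → Submodule K g} [DirectSum.Decomposition 𝔤] (L : LieSuperalgebra 𝔤)
variable {m n : ℕ} (b : Module.Basis (Fin m ⊕ Fin n) K g) {p : Fin m ⊕ Fin n → ZMod 2}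
variable {Λ : Type*} [Ring Λ] [Algebra K Λ] {ℒ : ZMod 2 → Submodule K Λ} [Supercommutative ℒ]

/-- The multinomial theorem holds for the power of ∑ ζ_i ⊗ X_i in Λᵒᵖ ⊗ S(g), where the terms
commute. Symmetrising along ad~ turns the power into ad_z^r and each monomial in the X_i into s^K.
-/
theorem adExt_pow_eq_sum (hb : ∀ i, b i ∈ 𝔤 (p i)) (hp : ∀ j, p (Sum.inr j) = 1)
    (ζ : Fin m ⊕ Fin n → Λ) (hζ : ∀ i, ζ i ∈ ℒ (p i)) (r : ℕ) :
    adExt L (∑ i, ζ i ⊗ₜ b i) ^ r = ∑ k ∈ MultiIndex.ofLength m n r,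
      ((r.factorial : K) / (k.factorial : K)) •
        oppositeAction K Λ g ((k.monomial fun i => MulOpposite.op (ζ i)) ⊗ₜ sOp b L k) := by
  have he : ∀ i j, MulOpposite.op (ζ i) * MulOpposite.op (ζ j) =
      sgn K (p i) (p j) • (MulOpposite.op (ζ j) * MulOpposite.op (ζ i)) := by
    intro i j
    rw [← MulOpposite.op_mul, ← MulOpposite.op_mul, Supercommutative.comm (hζ j) (hζ i),
      sgn_comm, MulOpposite.op_smul]
  have h1 := symmetrisation_pow 𝔤 L.adTilde p (fun i => MulOpposite.op (ζ i)) he b hb r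
  rw [MultiIndex.sum_pow_eq_sum_monomial (K := K)
    (fun i => MulOpposite.op (ζ i) ⊗ₜ[K] SSym.ι 𝔤 (b i))] at h1
  · rw [← oppositeAction_sum, ← map_pow, ← h1, map_sum, map_sum]
    refine Finset.sum_congr rfl fun k _ => ?_
    rw [map_smul, map_smul, MultiIndex.monomial_eq_prod_toList, list_prod_tmul,
      ← MultiIndex.monomial_eq_prod_toList, ← MultiIndex.monomial_eq_prod_toList,
      LinearMap.lTensor_tmul]
    rfl
  · intro i j
    simp only [Commute, SemiconjBy, Algebra.TensorProduct.tmul_mul_tmul]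
    rw [he i j, SSym.ι_comm 𝔤 (hb i) (hb j), TensorProduct.smul_tmul_smul, sgn_mul_self, one_smul]
  · intro j
    rw [Algebra.TensorProduct.tmul_mul_tmul, ι_mul_self_of_odd (hp j ▸ hb (Sum.inr j)),
      TensorProduct.tmul_zero]

/-- On z^N both sides are N!/(N−r)! times the same sum: the left one after expansion of ad_z^r into
the s^K, the right one because ∂^K z^N produces the matching monomial in the ζ_i. -/
theorem mulMap_adDeriv_pow_eq_sum (hb : ∀ i, b i ∈ 𝔤 (p i)) (hp : ∀ j, p (Sum.inr j) = 1)
    (r : ℕ) (x : g) (y : SSym 𝔤) : mulMap 𝔤 ((adDeriv L b ^ r) (x ⊗ₜ y)) =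
      ∑ k ∈ MultiIndex.ofLength m n r, ((r.factorial : K) / (k.factorial : K)) •
        (SSym.ι 𝔤 (sOp b L k x) * partialK b 𝔤 k y) := by
  let G : SSym 𝔤 →ₗ[K] SSym 𝔤 := ∑ k ∈ MultiIndex.ofLength m n r,
    ((r.factorial : K) / (k.factorial : K)) •
      (LinearMap.mulLeft K (SSym.ι 𝔤 (sOp b L k x)) ∘ₗ partialK b 𝔤 k)
  have h : mulMap 𝔤 ∘ₗ (adDeriv L b ^ r) ∘ₗ TensorProduct.mk K g (SSym 𝔤) x - G = 0 := by
    -- The formula for powers of D holds for any w, so 1 ⊗ x is admissible for every x, and the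
    -- multipliers `e` and `f` play no role.
    refine eq_zero_of_evenPoints 𝔤 _ 0 0 fun e _ f _ z hz N => ?_
    rw [LinearMap.lTensor_sub, LinearMap.sub_apply]
    refine (congrArg _ (sub_eq_zero.2 ?_)).trans (map_zero _)
    have hbox : (TensorProduct.mk K g (SSym 𝔤) x).lTensor (Grassmann K)
        (incl (Grassmann K) 𝔤 z ^ N) = boxExt (Grassmann K) 𝔤 (1 ⊗ₜ x)
          (incl (Grassmann K) 𝔤 z ^ N) := by
      generalize incl (Grassmann K) 𝔤 z ^ N = u
      induction u using TensorProduct.induction_on with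
      | zero => simp
      | add u v hu hv => simp only [map_add, hu, hv]
      | tmul a u => simp
    rw [LinearMap.lTensor_comp, LinearMap.lTensor_comp, LinearMap.comp_apply,
      LinearMap.comp_apply, hbox, ← LinearMap.lTensor_pow, lTensor_adDeriv_pow_pow L b hb hz,
      map_nsmul, lTensor_mulMap_boxExt]
    obtain ⟨ζ, hζ, rfl⟩ := exists_eq_sum_of_mem_evenPoints b hb hz
    rw [adExt_pow_eq_sum L b hb hp ζ hζ, LinearMap.sum_apply, map_sum, Finset.sum_mul,
      Finset.smul_sum]
    have hG : ∀ u, G.lTensor (Grassmann K) u = ∑ k ∈ MultiIndex.ofLength m n r,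
        ((r.factorial : K) / (k.factorial : K)) • ((1 ⊗ₜ SSym.ι 𝔤 (sOp b L k x)) *
          (partialK b 𝔤 k).lTensor (Grassmann K) u) := by
      intro u
      induction u using TensorProduct.induction_on with
      | zero => simp
      | add u v hu hv => simp only [map_add, hu, hv, mul_add, smul_add, Finset.sum_add_distrib]
      | tmul a u => simp [G, TensorProduct.tmul_sum]
    rw [hG]
    refine Finset.sum_congr rfl fun k hk => ?_
    rw [MultiIndex.mem_ofLength] at hk
    rw [LinearMap.smul_apply, oppositeAction_tmul, map_smul, incl_tmul, one_mul, partialK,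
      MultiIndex.monomial_eq_prod_toList k fun i => pderiv 𝔤 (b.coord i),
      lTensor_list_prod_pderiv b hb ζ hζ, MultiIndex.length_toList, hk,
      ← MultiIndex.monomial_eq_prod_toList, mul_smul_comm, smul_comm, smul_mul_assoc, ← mul_assoc,
      Algebra.TensorProduct.tmul_mul_tmul, one_mul, mul_one]
  have h' := sub_eq_zero.1 (LinearMap.congr_fun h y)
  simpa [G] using h'

theorem seriesAction_eq_finsum (hb : ∀ i, b i ∈ 𝔤 (p i)) (hp : ∀ j, p (Sum.inr j) = 1) (x : g)
    (y : SSym 𝔤) : seriesAction L b hb (bernoulliCoeff K) x y = ∑ᶠ k : MultiIndex m n,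
      ((-1) ^ k.length * (bernoulli k.length : K) / (k.factorial : K)) •
        (SSym.ι 𝔤 (sOp b L k x) * partialK b 𝔤 k y) := by
  obtain ⟨N, hN⟩ := exists_mem_symFiltration 𝔤 y
  have h1 : seriesAction L b hb (bernoulliCoeff K) x y = ∑ r ∈ Finset.range N,
      bernoulliCoeff K r • mulMap 𝔤 ((adDeriv L b ^ r) (x ⊗ₜ y)) := by
    have := seriesEnd_apply (bernoulliCoeff K) (adDeriv L b) (adDeriv_locallyNilpotent L b hb)
      (m := x ⊗ₜ y) (n := N) (fun r hr => adDeriv_pow_tmul L b hb hN x hr)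
    simp [seriesAction, this]
  have hd : (↑(Finset.range N) : Set ℕ).PairwiseDisjoint (MultiIndex.ofLength m n) := by
    intro r _ s _ hrs
    rw [Function.onFun, Finset.disjoint_left]
    intro k hk hk'
    rw [MultiIndex.mem_ofLength] at hk hk'
    exact hrs (hk.symm.trans hk')
  classical
  rw [h1, finsum_eq_sum_of_support_subset (s := (Finset.range N).biUnion
    (MultiIndex.ofLength m n)), Finset.sum_biUnion hd]
  · refine Finset.sum_congr rfl fun r _ => ?_
    rw [mulMap_adDeriv_pow_eq_sum L b hb hp, Finset.smul_sum]
    refine Finset.sum_congr rfl fun k hk => ?_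
    rw [MultiIndex.mem_ofLength] at hk
    rw [smul_smul, hk]
    congr 1
    have hr : (r.factorial : K) ≠ 0 := by exact_mod_cast r.factorial_ne_zero
    -- The sign exchanges the conventions B_1 = −1/2 and B_1 = 1/2; the factor r! of the multinomial
    -- coefficient cancels the denominator of c_r.
    have hB : (-1) ^ r * (bernoulli r : K) = (bernoulli' r : K) := by
      rw [bernoulli]
      push_cast
      rw [← mul_assoc, ← mul_pow]
      simp
    rw [hB, bernoulliCoeff]
    field_simp
  · intro k hk
    simp only [Finset.coe_biUnion, Finset.mem_coe, Finset.mem_range, Set.mem_iUnion,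
      MultiIndex.mem_ofLength, exists_prop, exists_eq_right']
    by_contra h
    exact hk (by simp only [partialK_eq_zero b hb hN (not_lt.1 h), mul_zero, smul_zero])

end BerezinFormula

end SuperLie

theorem theorem3p2 {𝕜 g : Type*} [RCLike 𝕜] [AddCommGroup g] [Module 𝕜 g]
    (𝔤 : ZMod 2 → Submodule 𝕜 g) [DirectSum.Decomposition 𝔤] (L : SuperLie.LieSuperalgebra 𝔤)
    {m n : ℕ} (b : Module.Basis (Fin m ⊕ Fin n) 𝕜 g)
    (hb0 : ∀ i : Fin m, b (Sum.inl i) ∈ 𝔤 0) (hb1 : ∀ j : Fin n, b (Sum.inr j) ∈ 𝔤 1) :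
    ∃ hσ : Function.Bijective L.sym, ∀ (X : g) (Y : SuperLie.SSym 𝔤),
      {k : SuperLie.MultiIndex m n | SuperLie.partialK b 𝔤 k Y ≠ 0}.Finite ∧
      L.leftAction hσ X Y = ∑ᶠ k : SuperLie.MultiIndex m n,
        ((-1) ^ k.length * (bernoulli k.length : 𝕜) / (k.factorial : 𝕜)) •
          (SuperLie.SSym.ι 𝔤 (SuperLie.sOp b L k X) * SuperLie.partialK b 𝔤 k Y) := by
  have hb : ∀ i, b i ∈ 𝔤 (Sum.elim (fun _ => 0) (fun _ => 1) i : ZMod 2) := by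
    rintro (i | j)
    · exact hb0 i
    · exact hb1 j
  refine ⟨SuperLie.sym_bijective L b hb, fun X Y =>
    ⟨SuperLie.finite_partialK_ne_zero b hb Y, ?_⟩⟩
  rw [SuperLie.leftAction_eq_seriesAction L b hb,
    SuperLie.seriesAction_eq_finsum L b hb (fun _ => rfl)]
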